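/- Let $n\ge 2$, and let $\mathbb H^n=\mathbb R^{4n}$ have quaternionic coordinates $q_0,\dots,q_{n-1}$, where $q_a=h_{4a+1}+h_{4a+2}\,i+h_{4a+3}\,j+h_{4a+4}\,k$. For $x\in\mathbb H^n$ let $A_x$ be the endomorphism of $T_x\mathbb H^n=\mathbb H^n$ for which $A_xY$ has the entry $\langle x_0i,Y_0\rangle\,x_0i$ in position $1$ and zeros elsewhere; thus $A_x^2=0$. For an imaginary quaternion $p$ let $I_p(x)=(1+A_x)^{-1}\,L_p\,(1+A_x)$, where $L_p$ is left multiplication of all entries by $p$. The fields $I=I_i$, $J=I_j$, $K=I_k$ form a hypercomplex structure, and the bundle $Q=\operatorname{span}\{I,J,K\}\subset\operatorname{End}(T\mathbb H^n)$ is the (locally hypercomplex) submaximally symmetric quaternionic model of Kruglikov, Winther and Zalabová in these coordinates. Let $\mathfrak g$ be the Lie algebra of its infinitesimal quaternionic symmetries, i.e. of the smooth vector fields $V$ on $\mathbb H^n$ such that the Lie derivative $\mathcal L_V$ maps local smooth sections of $Q$ to sections of $Q$. Let $$v=\sum_{a=0}^{n-1}\bigl(h_{4a+4}\,\partial_{h_{4a+3}}-h_{4a+3}\,\partial_{h_{4a+4}}\bigr)\in\mathfrak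 g$$ be the generator of the circle action, let $S=\{x: v(x)=0\}=\{h_j=0 \text{ for } j\equiv 3,4 \bmod 4\}$ be its fixed set, and let $N(v)=\{X\in\mathfrak g:[X,v]\in\mathbb R v\}$ be the normalizer algebra of $v$ in $\mathfrak g$. Then $N(v)$ restricts to $S$ and acts locally transitively on $S$: every $X\in N(v)$ is tangent to $S$ at all points of $S$, and for every $x\in S$ the values $X(x)$ with $X\in N(v)$ fill the whole tangent space $T_xS$. Moreover $\dim N(v)=2n^2-2n+5$. -/

import Mathlib

open scoped ContDiff Quaternion

noncomputable section

namespace QuaternionicModel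

/-! ### Smooth vector fields on a normed space, with their Lie bracket -/

section VectorFields

variable (E : Type*) [NormedAddCommGroup E] [NormedSpace ℝ E]

/-- The real vector space of smooth vector fields on `E`. -/
def smoothFields : Submodule ℝ (E → E) where
  carrier := {V | ContDiff ℝ ∞ V}
  add_mem' {V W} (hV : ContDiff ℝ ∞ V) (hW : ContDiff ℝ ∞ W) := hV.add hW
  zero_mem' := show ContDiff ℝ ∞ fun _ : E => (0 : E) from contDiff_const
  smul_mem' c V (hV : ContDiff ℝ ∞ V) := hV.const_smul c

variable {E}

theorem contDiff_coe (V : smoothFields E) : ContDiff ℝ ∞ (V : E → E) := V.2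

theorem differentiable_coe (V : smoothFields E) : Differentiable ℝ (V : E → E) :=
  (contDiff_coe V).differentiable (by simp)

/-- The bracket `[V, W] = DW(V) - DV(W)` of vector fields. -/
instance : Bracket (smoothFields E) (smoothFields E) where
  bracket V W := ⟨VectorField.lieBracket ℝ V W,
    show ContDiff ℝ ∞ _ from (contDiff_coe V).lieBracket_vectorField (contDiff_coe W) (by simp)⟩

theorem coe_bracket (V W : smoothFields E) :
    ((⁅V, W⁆ : smoothFields E) : E → E) = VectorField.lieBracket ℝ V W := rfl

instance : LieRing (smoothFields E) where
  add_lie U V W := Subtype.ext <| funext fun x =>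
    VectorField.lieBracket_add_left (differentiable_coe U x) (differentiable_coe V x)
  lie_add U V W := Subtype.ext <| funext fun x =>
    VectorField.lieBracket_add_right (differentiable_coe V x) (differentiable_coe W x)
  lie_self V := Subtype.ext VectorField.lieBracket_self
  leibniz_lie U V W := Subtype.ext <| funext fun x =>
    VectorField.leibniz_identity_lieBracket (n := ∞) (by
      rw [minSmoothness_of_isRCLikeNormedField]; exact WithTop.coe_le_coe.2 (le_top : (2 : ℕ∞) ≤ ⊤))
      (contDiff_coe U).contDiffAt (contDiff_coe V).contDiffAt (contDiff_coe W).contDiffAt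

instance : LieAlgebra ℝ (smoothFields E) where
  lie_smul _ _ W := Subtype.ext <| funext fun x =>
    VectorField.lieBracket_const_smul_right (differentiable_coe W x)

/-- The Lie derivative `L_V s` of a field `s` of endomorphisms of the tangent spaces of `E`:
`(L_V s)(Y) = [V, s Y] - s [V, Y]` for every vector field `Y`. -/
def lieDeriv (V : E → E) (s : E → E →L[ℝ] E) (x : E) : E →L[ℝ] E :=
  fderiv ℝ s x (V x) - (fderiv ℝ V x).comp (s x) + (s x).comp (fderiv ℝ V x)

theorem lieDeriv_apply {V Y : E → E} {s : E → E →L[ℝ] E} {x : E}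
    (hs : DifferentiableAt ℝ s x) (hY : DifferentiableAt ℝ Y x) :
    lieDeriv V s x (Y x) = VectorField.lieBracket ℝ V (fun y => s y (Y y)) x
      - s x (VectorField.lieBracket ℝ V Y x) := by
  simp only [VectorField.lieBracket, lieDeriv]
  rw [fderiv_clm_apply hs hY]
  simp
  abel

theorem lieDeriv_add (V W : smoothFields E) (s : E → E →L[ℝ] E) (x : E) :
    lieDeriv ((V + W : smoothFields E) : E → E) s x = lieDeriv V s x + lieDeriv W s x := by
  have h : fderiv ℝ ((V + W : smoothFields E) : E → E) x
      = fderiv ℝ (V : E → E) x + fderiv ℝ (W : E → E) x :=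
    fderiv_add (differentiable_coe V x) (differentiable_coe W x)
  have h0 : ((V + W : smoothFields E) : E → E) x = (V : E → E) x + (W : E → E) x := rfl
  ext w
  simp only [lieDeriv, h, h0, map_add, ContinuousLinearMap.add_comp, ContinuousLinearMap.comp_add,
    add_apply, sub_apply]
  abel

theorem lieDeriv_smul (c : ℝ) (V : smoothFields E) (s : E → E →L[ℝ] E) (x : E) :
    lieDeriv ((c • V : smoothFields E) : E → E) s x = c • lieDeriv V s x := by
  have h : fderiv ℝ ((c • V : smoothFields E) : E → E) x = c • fderiv ℝ (V : E → E) x :=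
    fderiv_const_smul (differentiable_coe V x) c
  have h0 : ((c • V : smoothFields E) : E → E) x = c • (V : E → E) x := rfl
  simp only [lieDeriv, h, h0, map_smul, ContinuousLinearMap.smul_comp,
    ContinuousLinearMap.comp_smul, smul_sub, smul_add]

theorem contDiffOn_lieDeriv {V : E → E} {s : E → E →L[ℝ] E} {U : Set E} (hU : IsOpen U)
    (hV : ContDiff ℝ ∞ V) (hs : ContDiffOn ℝ ∞ s U) : ContDiffOn ℝ ∞ (lieDeriv V s) U := by
  have h1 : ContDiffOn ℝ ∞ (fderiv ℝ s) U := hs.fderiv_of_isOpen hU (by simp)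
  have h2 : ContDiff ℝ ∞ (fderiv ℝ V) := hV.fderiv_right (by simp)
  exact ((h1.clm_apply hV.contDiffOn).sub (h2.contDiffOn.clm_comp hs)).add
    (hs.clm_comp h2.contDiffOn)

theorem lieDeriv_lieBracket {V W : E → E} {s : E → E →L[ℝ] E} {U : Set E} (hU : IsOpen U)
    (hV : ContDiff ℝ ∞ V) (hW : ContDiff ℝ ∞ W) (hs : ContDiffOn ℝ ∞ s U) {x : E} (hx : x ∈ U) :
    lieDeriv (VectorField.lieBracket ℝ V W) s x
      = lieDeriv V (lieDeriv W s) x - lieDeriv W (lieDeriv V s) x := by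
  have hUx : U ∈ nhds x := hU.mem_nhds hx
  have smooth_le : minSmoothness ℝ 2 ≤ ∞ := by
    rw [minSmoothness_of_isRCLikeNormedField]; exact WithTop.coe_le_coe.2 (le_top : (2 : ℕ∞) ≤ ⊤)
  have d : ∀ {F : Type _} [NormedAddCommGroup F] [NormedSpace ℝ F] {f : E → F},
      ContDiffOn ℝ ∞ f U → DifferentiableAt ℝ f x :=
    fun hf => (hf.contDiffAt hUx).differentiableAt (by simp)
  ext w
  have sw : ContDiffOn ℝ ∞ (fun y => s y w) U := hs.clm_apply contDiffOn_const
  have cw : ContDiff ℝ ∞ (fun _ : E => w) := contDiff_const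
  have key : ∀ {V W : E → E}, ContDiff ℝ ∞ V → ContDiff ℝ ∞ W →
      lieDeriv V (lieDeriv W s) x w =
        VectorField.lieBracket ℝ V (VectorField.lieBracket ℝ W fun y => s y w) x
        - lieDeriv V s x (VectorField.lieBracket ℝ W (fun _ => w) x)
        - s x (VectorField.lieBracket ℝ V (VectorField.lieBracket ℝ W fun _ => w) x)
        - lieDeriv W s x (VectorField.lieBracket ℝ V (fun _ => w) x) := by
    intro V W hV hW
    have hWc : ContDiff ℝ ∞ (VectorField.lieBracket ℝ W fun _ => w) :=
      hW.lieBracket_vectorField cw (by simp)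
    have hWs : DifferentiableAt ℝ (VectorField.lieBracket ℝ W fun y => s y w) x :=
      ((hW.contDiffAt (x := x)).lieBracket_vectorField (m := ∞)
        (sw.contDiffAt hUx) (by simp)).differentiableAt (by simp)
    have hG : DifferentiableAt ℝ (fun y => s y (VectorField.lieBracket ℝ W (fun _ => w) y)) x :=
      d (hs.clm_apply hWc.contDiffOn)
    have e : (fun y => lieDeriv W s y w) =ᶠ[nhds x]
        (VectorField.lieBracket ℝ W fun y => s y w)
          - fun y => s y (VectorField.lieBracket ℝ W (fun _ => w) y) := by
      filter_upwards [hUx] with y hy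
      exact lieDeriv_apply (Y := fun _ => w)
        ((hs.contDiffAt (hU.mem_nhds hy)).differentiableAt (by simp)) (differentiableAt_const w)
    have h1 := lieDeriv_apply (V := V) (Y := fun _ => w) (d (contDiffOn_lieDeriv hU hW hs))
      (differentiableAt_const w)
    have h2 := lieDeriv_apply (V := V) (d hs) (hWc.differentiable (by simp) x)
    have h3 : VectorField.lieBracket ℝ V (fun y => lieDeriv W s y w) x
        = VectorField.lieBracket ℝ V (VectorField.lieBracket ℝ W fun y => s y w) x
          - VectorField.lieBracket ℝ V
              (fun y => s y (VectorField.lieBracket ℝ W (fun _ => w) y)) x := by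
      simp only [VectorField.lieBracket_eq] at *
      rw [e.fderiv_eq, e.eq_of_nhds, fderiv_sub hWs hG]
      simp
      abel
    rw [h1, h3, h2]
    abel
  have h0 := lieDeriv_apply (V := VectorField.lieBracket ℝ V W) (Y := fun _ => w) (d hs)
    (differentiableAt_const w)
  have j1 := VectorField.leibniz_identity_lieBracket smooth_le (x := x) hV.contDiffAt
    hW.contDiffAt (sw.contDiffAt hUx)
  have j2 := VectorField.leibniz_identity_lieBracket smooth_le (x := x) hV.contDiffAt
    hW.contDiffAt cw.contDiffAt
  rw [sub_apply, key hV hW, key hW hV, h0, j1, j2, map_add]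
  abel

/-- The Lie algebra of infinitesimal symmetries of a bundle `Q` of endomorphisms: the smooth vector
fields `V` such that `L_V` maps (local) smooth sections of `Q` to sections of `Q`. -/
def symmetryAlgebra (Q : E → Submodule ℝ (E →L[ℝ] E)) : LieSubalgebra ℝ (smoothFields E) where
  carrier := {V | ∀ U : Set E, IsOpen U → ∀ s : E → E →L[ℝ] E, ContDiffOn ℝ ∞ s U →
    (∀ x ∈ U, s x ∈ Q x) → ∀ x ∈ U, lieDeriv V s x ∈ Q x}
  add_mem' {V W} hV hW U hU s hs hsQ x hx := by
    rw [lieDeriv_add]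
    exact (Q x).add_mem (hV U hU s hs hsQ x hx) (hW U hU s hs hsQ x hx)
  zero_mem' U hU s hs hsQ x hx := by
    rw [← zero_smul ℝ (0 : smoothFields E), lieDeriv_smul, zero_smul]
    exact (Q x).zero_mem
  smul_mem' c V hV U hU s hs hsQ x hx := by
    rw [lieDeriv_smul]
    exact (Q x).smul_mem c (hV U hU s hs hsQ x hx)
  lie_mem' {V W} hV hW U hU s hs hsQ x hx := by
    rw [coe_bracket, lieDeriv_lieBracket hU (contDiff_coe V) (contDiff_coe W) hs hx]
    exact (Q x).sub_mem
      (hV U hU _ (contDiffOn_lieDeriv hU (contDiff_coe W) hs) (hW U hU s hs hsQ) x hx)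
      (hW U hU _ (contDiffOn_lieDeriv hU (contDiff_coe V) hs) (hV U hU s hs hsQ) x hx)

end VectorFields

/-! ### The submaximal quaternionic model -/

/-- The underlying manifold `ℍⁿ = ℝ⁴ⁿ`. The real coordinates are
`h_{4a+1}, h_{4a+2}, h_{4a+3}, h_{4a+4} = re, imI, imJ, imK` of `q a`, for `a = 0, …, n - 1`. -/
abbrev Space (n : ℕ) : Type := Fin n → ℍ[ℝ]

/-- Left multiplication of all coordinates by the quaternion `p`. -/
def leftMul (n : ℕ) (p : ℍ[ℝ]) : Space n →L[ℝ] Space n :=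
  ContinuousLinearMap.pi fun a =>
    (ContinuousLinearMap.mul ℝ ℍ[ℝ] p).comp (ContinuousLinearMap.proj a)

theorem leftMul_apply {n : ℕ} (p : ℍ[ℝ]) (Y : Space n) (a : Fin n) :
    leftMul n p Y a = p * Y a := rfl

/-- The imaginary unit `i`. -/
def qi : ℍ[ℝ] := ⟨0, 1, 0, 0⟩

/-- The imaginary unit `j`. -/
def qj : ℍ[ℝ] := ⟨0, 0, 1, 0⟩

/-- The imaginary unit `k`. -/
def qk : ℍ[ℝ] := ⟨0, 0, 0, 1⟩

/-- The nilpotent endomorphism `A_x` of `T_x ℍⁿ = ℍⁿ`: the vector `A_x Y` has the second entry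
`⟨x₀ i, Y₀⟩ x₀ i` and all other entries zero. -/
def shear {n : ℕ} (hn : 2 ≤ n) (x : Space n) : Space n →L[ℝ] Space n :=
  (ContinuousLinearMap.single ℝ (fun _ : Fin n => ℍ[ℝ]) ⟨1, by omega⟩).comp
    (((innerSL ℝ (x ⟨0, by omega⟩ * qi)).smulRight (x ⟨0, by omega⟩ * qi)).comp
      (ContinuousLinearMap.proj ⟨0, by omega⟩))

/-- The endomorphism field `(1 + A_x)⁻¹ p (1 + A_x)`, where `(1 + A_x)⁻¹ = 1 - A_x`. -/
def complexStr {n : ℕ} (hn : 2 ≤ n) (p : ℍ[ℝ]) (x : Space n) : Space n →L[ℝ] Space n :=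
  (1 - shear hn x) * leftMul n p * (1 + shear hn x)

/-- The quaternionic structure: the rank three bundle `Q = span {I, J, K} ⊆ End (T ℍⁿ)`, where
`I, J, K` are the almost complex structures `(1 + A)⁻¹ p (1 + A)` for `p = i, j, k`. -/
def quatBundle {n : ℕ} (hn : 2 ≤ n) (x : Space n) : Submodule ℝ (Space n →L[ℝ] Space n) :=
  Submodule.span ℝ {complexStr hn qi x, complexStr hn qj x, complexStr hn qk x}

/-- The Lie algebra of infinitesimal quaternionic symmetries of the model. -/
def modelSymmetries {n : ℕ} (hn : 2 ≤ n) : LieSubalgebra ℝ (smoothFields (Space n)) :=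
  symmetryAlgebra (quatBundle hn)

theorem shear_apply_one {n : ℕ} (hn : 2 ≤ n) (x Y : Space n) :
    shear hn x Y ⟨1, by omega⟩
      = inner ℝ (x ⟨0, by omega⟩ * qi) (Y ⟨0, by omega⟩) • (x ⟨0, by omega⟩ * qi) := by
  simp [shear]

theorem shear_apply_of_ne {n : ℕ} (hn : 2 ≤ n) (x Y : Space n) {a : Fin n}
    (ha : a ≠ ⟨1, by omega⟩) : shear hn x Y a = 0 := by
  simp [shear, ha]

theorem shear_eq_zero {n : ℕ} (hn : 2 ≤ n) (x Y : Space n) (hY : Y ⟨0, by omega⟩ = 0) :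
    shear hn x Y = 0 := by
  simp [shear, hY]

theorem shear_mul_mul_shear {n : ℕ} (hn : 2 ≤ n) (x : Space n) (p : ℍ[ℝ]) :
    shear hn x * leftMul n p * shear hn x = 0 := by
  ext1 Y
  exact shear_eq_zero hn x _ (by
    change leftMul n p (shear hn x Y) _ = 0
    rw [leftMul_apply, shear_apply_of_ne hn x Y (by simp), mul_zero])

theorem shear_sq {n : ℕ} (hn : 2 ≤ n) (x : Space n) : shear hn x * shear hn x = 0 := by
  ext1 Y
  exact shear_eq_zero hn x _ (shear_apply_of_ne hn x Y (by simp))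

/-- For `p, q` among `i, j, k` these are the quaternionic relations `I² = J² = K² = -1` and
`I J = K = -J I` of the almost complex structures `I, J, K`. -/
theorem complexStr_mul {n : ℕ} (hn : 2 ≤ n) (p q : ℍ[ℝ]) (x : Space n) :
    complexStr hn p x * complexStr hn q x = complexStr hn (p * q) x := by
  have h : (1 + shear hn x) * (1 - shear hn x) = 1 := by
    rw [add_mul, mul_sub, mul_sub, shear_sq]
    simp
  have hL : leftMul n (p * q) = leftMul n p * leftMul n q := by
    ext1 Y
    funext a
    exact mul_assoc p q (Y a)
  calc complexStr hn p x * complexStr hn q x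
      = (1 - shear hn x) * leftMul n p * ((1 + shear hn x) * (1 - shear hn x))
          * leftMul n q * (1 + shear hn x) := by simp only [complexStr, mul_assoc]
    _ = complexStr hn (p * q) x := by rw [h, complexStr, hL, mul_one, mul_assoc (1 - shear hn x)]

theorem complexStr_eq {n : ℕ} (hn : 2 ≤ n) (p : ℍ[ℝ]) (x : Space n) :
    complexStr hn p x = leftMul n p + leftMul n p * shear hn x - shear hn x * leftMul n p := by
  have h := shear_mul_mul_shear hn x p
  rw [complexStr, mul_add, sub_mul, sub_mul, sub_mul, h]
  simp
  abel

/-- The generator `v = ∑ (h_{4a+4} ∂_{h_{4a+3}} - h_{4a+3} ∂_{h_{4a+4}})` of the circle action, as a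
continuous linear map. -/
def rotationL (n : ℕ) : Space n →L[ℝ] Space n :=
  ContinuousLinearMap.pi fun a =>
    ((2 : ℝ)⁻¹ • ((ContinuousLinearMap.mul ℝ ℍ[ℝ]).flip qi - ContinuousLinearMap.mul ℝ ℍ[ℝ] qi)).comp
      (ContinuousLinearMap.proj a)

theorem rotationL_apply' {n : ℕ} (q : Space n) (a : Fin n) :
    rotationL n q a = (2 : ℝ)⁻¹ • (q a * qi - qi * q a) := by
  simp [rotationL]

theorem qi_re : qi.re = 0 := rfl
theorem qi_imI : qi.imI = 1 := rfl
theorem qi_imJ : qi.imJ = 0 := rfl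
theorem qi_imK : qi.imK = 0 := rfl

theorem rotation_skew (u Y : ℍ[ℝ]) : inner ℝ ((2 : ℝ)⁻¹ • (u * qi - qi * u)) Y
    = -inner ℝ u ((2 : ℝ)⁻¹ • (Y * qi - qi * Y)) := by
  rw [Quaternion.inner_def, Quaternion.inner_def]
  simp [qi_re, qi_imI, qi_imJ, qi_imK]
  ring

theorem rotationL_apply {n : ℕ} (q : Space n) :
    rotationL n q = fun a => ⟨0, 0, (q a).imK, -(q a).imJ⟩ := by
  funext a
  rw [rotationL_apply']
  ext <;> simp [qi_re, qi_imI, qi_imJ, qi_imK] <;> ring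

/-- The generator `v = ∑ (h_{4a+4} ∂_{h_{4a+3}} - h_{4a+3} ∂_{h_{4a+4}})` of the circle action. -/
def rotation (n : ℕ) : smoothFields (Space n) :=
  ⟨fun q a => ⟨0, 0, (q a).imK, -(q a).imJ⟩, by
    have h : (fun (q : Space n) (a : Fin n) => (⟨0, 0, (q a).imK, -(q a).imJ⟩ : ℍ[ℝ]))
        = rotationL n := funext fun q => (rotationL_apply q).symm
    rw [h]
    exact show ContDiff ℝ ∞ (rotationL n) from (rotationL n).contDiff⟩

theorem coe_rotation (n : ℕ) : (rotation n : Space n → Space n) = rotationL n :=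
  funext fun q => (rotationL_apply q).symm

theorem contDiff_shear {n : ℕ} (hn : 2 ≤ n) : ContDiff ℝ ∞ (shear hn) := by
  have c : ContDiff ℝ ∞ fun x : Space n => x ⟨0, by omega⟩ * qi :=
    (contDiff_apply ℝ ℍ[ℝ] _).mul contDiff_const
  rw [contDiff_clm_apply_iff]
  intro Y
  exact (ContinuousLinearMap.single ℝ (fun _ : Fin n => ℍ[ℝ]) ⟨1, by omega⟩).contDiff.comp
    ((c.inner ℝ (contDiff_const (c := Y ⟨0, by omega⟩))).smul c)

/-- The field of endomorphisms `A` is invariant under the circle action. -/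
theorem fderiv_shear {n : ℕ} (hn : 2 ≤ n) (x : Space n) :
    fderiv ℝ (shear hn) x (rotationL n x)
      = rotationL n * shear hn x - shear hn x * rotationL n := by
  ext1 Y
  have hd : DifferentiableAt ℝ (shear hn) x := (contDiff_shear hn).differentiable (by simp) x
  have c : HasFDerivAt (fun x : Space n => x ⟨0, by omega⟩ * qi)
      (((ContinuousLinearMap.mul ℝ ℍ[ℝ]).flip qi).comp
        (ContinuousLinearMap.proj (R := ℝ) (φ := fun _ : Fin n => ℍ[ℝ]) ⟨0, by omega⟩)) x :=
    ContinuousLinearMap.hasFDerivAt (((ContinuousLinearMap.mul ℝ ℍ[ℝ]).flip qi).comp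
        (ContinuousLinearMap.proj (R := ℝ) (φ := fun _ : Fin n => ℍ[ℝ]) ⟨0, by omega⟩))
  have h1 := hd.hasFDerivAt.clm_apply (hasFDerivAt_const Y x)
  have h3 := ((ContinuousLinearMap.single ℝ (fun _ : Fin n => ℍ[ℝ]) ⟨1, by omega⟩).hasFDerivAt).comp
    x ((c.inner ℝ (hasFDerivAt_const (Y ⟨0, by omega⟩) x)).smul c)
  have h4 := congrArg (fun L => L (rotationL n x)) (h1.unique h3)
  simp at h4
  rw [h4]
  funext a
  have hu : rotationL n x ⟨0, by omega⟩ * qi = (2 : ℝ)⁻¹ •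
      ((x ⟨0, by omega⟩ * qi) * qi - qi * (x ⟨0, by omega⟩ * qi)) := by
    rw [rotationL_apply', smul_mul_assoc, sub_mul, mul_assoc qi]
  change _ = rotationL n (shear hn x Y) a - shear hn x (rotationL n Y) a
  rw [hu, rotationL_apply' (shear hn x Y)]
  by_cases ha : a = ⟨1, by omega⟩
  · subst ha
    rw [shear_apply_one, shear_apply_one, rotationL_apply' Y, ← neg_eq_iff_eq_neg.2 (rotation_skew _ _)]
    simp only [Pi.add_apply, Pi.smul_apply, Pi.single_eq_same, smul_sub, smul_mul_assoc,
      mul_smul_comm, neg_smul, sub_neg_eq_add]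
    module
  · rw [shear_apply_of_ne hn x Y ha, shear_apply_of_ne hn x _ ha]
    simp [ha]

theorem leftMul_rotationL {n : ℕ} (p : ℍ[ℝ]) :
    leftMul n p * rotationL n - rotationL n * leftMul n p
      = leftMul n ((2 : ℝ)⁻¹ • (qi * p - p * qi)) := by
  ext1 Y
  funext a
  change p * rotationL n Y a - rotationL n (leftMul n p Y) a = _ * Y a
  rw [rotationL_apply', rotationL_apply', leftMul_apply]
  simp only [smul_sub, mul_sub, sub_mul, smul_mul_assoc, mul_smul_comm, mul_assoc]
  abel

/-- `leftMul` as a continuous linear map. -/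
def leftMulL (n : ℕ) : ℍ[ℝ] →L[ℝ] (Space n →L[ℝ] Space n) :=
  LinearMap.toContinuousLinearMap
    { toFun := leftMul n
      map_add' := fun p q => by
        ext1 Y
        funext a
        exact add_mul p q (Y a)
      map_smul' := fun c p => by
        ext1 Y
        funext a
        exact smul_mul_assoc c p (Y a) }

theorem leftMulL_apply (n : ℕ) (p : ℍ[ℝ]) : leftMulL n p = leftMul n p := rfl

theorem complexStr_combination {n : ℕ} (hn : 2 ≤ n) (p : ℍ[ℝ]) (hp : p.re = 0) (x : Space n) :
    p.imI • complexStr hn qi x + p.imJ • complexStr hn qj x + p.imK • complexStr hn qk x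
      = complexStr hn p x := by
  have h : leftMul n p = p.imI • leftMul n qi + p.imJ • leftMul n qj + p.imK • leftMul n qk := by
    have hq : p = p.imI • qi + p.imJ • qj + p.imK • qk := by
      have hi : qi.re = 0 ∧ qi.imI = 1 ∧ qi.imJ = 0 ∧ qi.imK = 0 := ⟨rfl, rfl, rfl, rfl⟩
      have hj : qj.re = 0 ∧ qj.imI = 0 ∧ qj.imJ = 1 ∧ qj.imK = 0 := ⟨rfl, rfl, rfl, rfl⟩
      have hk : qk.re = 0 ∧ qk.imI = 0 ∧ qk.imJ = 0 ∧ qk.imK = 1 := ⟨rfl, rfl, rfl, rfl⟩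
      ext <;> simp [hi, hj, hk, hp]
    conv_lhs => rw [hq, ← leftMulL_apply, map_add, map_add, map_smul, map_smul, map_smul]
    rfl
  rw [complexStr_eq, complexStr_eq, complexStr_eq, complexStr_eq, h]
  simp only [ContinuousLinearMap.mul_def, ContinuousLinearMap.add_comp,
    ContinuousLinearMap.comp_add, ContinuousLinearMap.smul_comp, ContinuousLinearMap.comp_smul]
  module

theorem mem_quatBundle {n : ℕ} (hn : 2 ≤ n) (x : Space n) (T : Space n →L[ℝ] Space n) :
    T ∈ quatBundle hn x ↔ ∃ p : ℍ[ℝ], p.re = 0 ∧ T = complexStr hn p x := by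
  rw [quatBundle, Submodule.mem_span_triple]
  constructor
  · rintro ⟨a, b, c, rfl⟩
    exact ⟨⟨0, a, b, c⟩, rfl, complexStr_combination hn ⟨0, a, b, c⟩ rfl x⟩
  · rintro ⟨p, hp, rfl⟩
    exact ⟨p.imI, p.imJ, p.imK, complexStr_combination hn p hp x⟩

theorem complexStr_single {n : ℕ} (hn : 2 ≤ n) (p : ℍ[ℝ]) (x : Space n) :
    complexStr hn p x (Pi.single ⟨1, by omega⟩ 1) ⟨1, by omega⟩ = p := by
  have h1 : shear hn x (Pi.single ⟨1, by omega⟩ 1) = 0 := shear_eq_zero hn x _ (by simp)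
  have h2 : shear hn x (leftMul n p (Pi.single ⟨1, by omega⟩ 1)) = 0 :=
    shear_eq_zero hn x _ (by simp [leftMul_apply])
  rw [complexStr_eq]
  change leftMul n p (Pi.single ⟨1, by omega⟩ 1) ⟨1, by omega⟩
    + leftMul n p (shear hn x (Pi.single ⟨1, by omega⟩ 1)) ⟨1, by omega⟩
    - shear hn x (leftMul n p (Pi.single ⟨1, by omega⟩ 1)) ⟨1, by omega⟩ = p
  rw [h1, h2]
  simp [leftMul_apply]

/-- The vector field `v` is an infinitesimal quaternionic symmetry. -/
theorem rotation_mem {n : ℕ} (hn : 2 ≤ n) : rotation n ∈ modelSymmetries hn := by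
  intro U hU s hs hsQ x hx
  have hUx : U ∈ nhds x := hU.mem_nhds hx
  set p : Space n → ℍ[ℝ] := fun y => s y (Pi.single ⟨1, by omega⟩ 1) ⟨1, by omega⟩ with hp
  have hps : ∀ y ∈ U, (p y).re = 0 ∧ s y = complexStr hn (p y) y := by
    intro y hy
    obtain ⟨q, hq, hsq⟩ := (mem_quatBundle hn y _).1 (hsQ y hy)
    have : p y = q := by rw [hp]; simp only [hsq]; exact complexStr_single hn q y
    rw [this]
    exact ⟨hq, hsq⟩
  have hpd : DifferentiableAt ℝ p x := by
    have h1 : ContDiffOn ℝ ∞ (fun y => s y (Pi.single ⟨1, by omega⟩ 1)) U :=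
      hs.clm_apply contDiffOn_const
    have h2 : DifferentiableAt ℝ (fun y => s y (Pi.single ⟨1, by omega⟩ 1)) x :=
      (h1.contDiffAt hUx).differentiableAt (by simp)
    exact differentiableAt_pi.1 h2 _
  have hre : (fderiv ℝ p x (rotationL n x)).re = 0 := by
    let reL : ℍ[ℝ] →L[ℝ] ℝ := innerSL ℝ (1 : ℍ[ℝ])
    have hreL : ∀ q : ℍ[ℝ], reL q = q.re := fun q => by
      simp [reL, Quaternion.inner_def]
    have e : (fun y => reL (p y)) =ᶠ[nhds x] fun _ => 0 := by
      filter_upwards [hUx] with y hy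
      rw [hreL, (hps y hy).1]
    have h1 := (reL.hasFDerivAt.comp x hpd.hasFDerivAt).unique
      ((hasFDerivAt_const (0 : ℝ) x).congr_of_eventuallyEq e)
    have h2 := congrArg (fun L => L (rotationL n x)) h1
    rw [← hreL]
    exact h2
  have hA : HasFDerivAt (shear hn) (fderiv ℝ (shear hn) x) x :=
    ((contDiff_shear hn).differentiable (by simp) x).hasFDerivAt
  have hL : HasFDerivAt (fun y => leftMul n (p y)) ((leftMulL n).comp (fderiv ℝ p x)) x :=
    HasFDerivAt.comp (g := leftMulL n) x (leftMulL n).hasFDerivAt hpd.hasFDerivAt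
  have e : s =ᶠ[nhds x] fun y =>
      leftMul n (p y) + (leftMul n (p y)).comp (shear hn y)
        - (shear hn y).comp (leftMul n (p y)) := by
    filter_upwards [hUx] with y hy
    rw [(hps y hy).2, complexStr_eq]
    rfl
  have hsd := ((hL.add (hL.clm_comp hA)).sub (hA.clm_comp hL)).congr_of_eventuallyEq e
  have hsv : fderiv ℝ s x (rotationL n x)
      = leftMul n (fderiv ℝ p x (rotationL n x))
        + (leftMul n (p x) * fderiv ℝ (shear hn) x (rotationL n x)
          + leftMul n (fderiv ℝ p x (rotationL n x)) * shear hn x)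
        - (shear hn x * leftMul n (fderiv ℝ p x (rotationL n x))
          + fderiv ℝ (shear hn) x (rotationL n x) * leftMul n (p x)) := by
    rw [hsd.fderiv]
    rfl
  rw [fderiv_shear] at hsv
  refine (mem_quatBundle hn x _).2
    ⟨fderiv ℝ p x (rotationL n x) + (2 : ℝ)⁻¹ • (qi * p x - p x * qi), ?_, ?_⟩
  · rw [Quaternion.re_add, hre]
    simp
    ring
  · have hfr : fderiv ℝ (rotation n : Space n → Space n) x = rotationL n := by
      rw [coe_rotation]
      exact (rotationL n).fderiv
    have hlie : lieDeriv (rotation n : Space n → Space n) s x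
        = fderiv ℝ s x (rotationL n x) - rotationL n * s x + s x * rotationL n := by
      rw [lieDeriv, hfr, coe_rotation]
      rfl
    have hadd : leftMul n (fderiv ℝ p x (rotationL n x) + (2 : ℝ)⁻¹ • (qi * p x - p x * qi))
        = leftMul n (fderiv ℝ p x (rotationL n x))
          + (leftMul n (p x) * rotationL n - rotationL n * leftMul n (p x)) := by
      rw [leftMul_rotationL]
      exact (leftMulL n).map_add _ _
    rw [hlie, hsv, (hps x hx).2, complexStr_eq, complexStr_eq, hadd]
    simp only [mul_sub, sub_mul, mul_add, add_mul, mul_assoc]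
    abel

/-- The circle generator `v` as an element of the symmetry algebra. -/
def circleGen {n : ℕ} (hn : 2 ≤ n) : modelSymmetries hn := ⟨rotation n, rotation_mem hn⟩

/-- The normalizer `N(v)` of (the line spanned by) `v` in the symmetry algebra. -/
def normalizerAlgebra {n : ℕ} (hn : 2 ≤ n) : LieSubalgebra ℝ (modelSymmetries hn) :=
  (LieSubalgebra.lieSpan ℝ (modelSymmetries hn) {circleGen hn}).normalizer

/-- The underlying vector field of an infinitesimal quaternionic symmetry. -/
def toField {n : ℕ} {hn : 2 ≤ n} (X : modelSymmetries hn) : Space n → Space n :=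
  ((X : smoothFields (Space n)) : Space n → Space n)

/-- The fixed set `S` of the circle action: the zero set of `v`. -/
def fixedSet (n : ℕ) : Set (Space n) := {x | (rotation n : Space n → Space n) x = 0}

end QuaternionicModel
end

/-!
Let `V` be a vector field on `ℍⁿ` and let `A` be the nilpotent field of endomorphisms defining the
model. Since the structures are the conjugates `(1 - A) p (1 + A)` of the left multiplications,
`V` is an infinitesimal symmetry exactly when the endomorphism `M = (1 + A) (DV + D_V A) (1 - A)`
normalizes the left multiplications by imaginary quaternions, that is, when `M` lies in
`gl(n, ℍ) + sp(1)` at each point: its entries are right multiplications, up to a left multiplication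
`r` common to the diagonal entries (`IsSym.exists_entries`, `isSym_of_entries`). The proof
integrates this overdetermined system of first order explicitly, and then takes brackets with `v`.

*Integration.* `A` depends on `q₀` only, so translations in the other coordinates are symmetries,
and derivatives of symmetries in these directions are again symmetries. The mechanism used
throughout is `eq_zero_of_mul_left_symm`: a map of two quaternionic variables which is of the form
`y p(z)` and also of the form `z q(y)` vanishes. By symmetry of second derivatives, a function whose
derivatives are right multiplications is therefore affine. It follows that symmetries are affine in
`q_b`, `b ≠ 0` (`IsSym.pd_pd_eq_zero`), and that the component `V₀` depends on `q₀` only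
(`IsSym.pd_apply_zero`).
The component `V₁` satisfies an equation in `q₀` whose right hand side contains terms quadratic in
`q₀`; its integrability conditions (`quadratic_integrability`) determine the relations between the
diagonal entries and the quadratic correction `quadMap`. A priori the common left multiplication is
`ρ + q₀ κ`; the bracket with the symmetries extending translations in the direction of `q₀` is again
a symmetry, and this forces `κ = 0` (`IsSym.kappa_eq_zero`). Hence (`IsSym.exists_eq_stdField`) the
symmetries are exactly the fields
`V_a = ρ q_a + τ_a + ∑ q_b E_{ba} + δ_{a1} quadMap τ₀ q₀` with imaginary `ρ`, arbitrary `τ`, and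
`E_{b0} = 0` for `b ≠ 0`, `E_{1a} = 0` for `a ≠ 1`, `E₀₀ ∈ ℂ`, `E₁₁ = E₀₀ + 2 Re E₀₀`.

*The normalizer.* The circle action is `q ↦ (q i - i q) / 2` in each coordinate. It is a derivation
of the quaternions with kernel `ℂ = ℝ + ℝ i`, and the bracket of a symmetry with `v` applies it to
the coefficients `ρ`, `τ`, `E` (`lieBracket_stdField`). In these terms `v` itself has `ρ = - i / 2`
and `E = i / 2`, which the derivation never produces, so `N(v)` consists of the symmetries with
coefficients in `ℂ`. Counting them gives the real dimension
`1 + 2 + 2 n + 2 (n - 1)² = 2 n² - 2 n + 5`, for `ρ`, `E₀₀`, `τ` and the `(n - 1)²` entries `E_{ba}`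
with `b ≠ 1`, `a ≠ 0`. These fields are tangent to `S = ℂⁿ`, and those with `ρ = 0`, `E = 0` already
have all tangent vectors of `S` as values at any of its points (`exists_toField_eq`).
-/

namespace QuaternionicModel

/-! ### Quaternionic algebra -/

attribute [simp] qi_re qi_imI qi_imJ qi_imK

@[simp] theorem qj_re : qj.re = 0 := rfl
@[simp] theorem qj_imI : qj.imI = 0 := rfl
@[simp] theorem qj_imJ : qj.imJ = 1 := rfl
@[simp] theorem qj_imK : qj.imK = 0 := rfl
@[simp] theorem qk_re : qk.re = 0 := rfl
@[simp] theorem qk_imI : qk.imI = 0 := rfl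
@[simp] theorem qk_imJ : qk.imJ = 0 := rfl
@[simp] theorem qk_imK : qk.imK = 1 := rfl

/-- A map of two variables which is of the form `y p(z)` and of the form `z q(y)` vanishes: `ℍ` is
not commutative. -/
theorem eq_zero_of_mul_left_symm {F : ℍ[ℝ] → ℍ[ℝ] → ℍ[ℝ]} {p q : ℍ[ℝ] → ℍ[ℝ]}
    (h1 : ∀ y z, F y z = y * p z) (h2 : ∀ y z, F y z = z * q y) (y z : ℍ[ℝ]) : F y z = 0 := by
  have hp : ∀ z, p z = z * q 1 := fun z => by rw [← h2, h1, one_mul]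
  have hq : ∀ y, q y = y * q 1 := fun y => by rw [← one_mul (q y), ← h2, h1, hp, one_mul]
  have h3 : qi * (qj * q 1) = qj * (qi * q 1) := by rw [← hp, ← hq, ← h1, h2]
  have h4 : q 1 = 0 := by
    rw [Quaternion.ext_iff] at h3 ⊢
    simp at h3 ⊢
    obtain ⟨h3, h4, h5, h6⟩ := h3
    refine ⟨?_, ?_, ?_, ?_⟩ <;> linarith
  rw [h1, hp, h4, mul_zero, mul_zero]

theorem eq_zero_of_mul_right_symm {F : ℍ[ℝ] → ℍ[ℝ] → ℍ[ℝ]} {p q : ℍ[ℝ] → ℍ[ℝ]}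
    (h1 : ∀ y z, F y z = p z * y) (h2 : ∀ y z, F y z = q y * z) (y z : ℍ[ℝ]) : F y z = 0 := by
  have h := eq_zero_of_mul_left_symm (F := fun y z => star (F (star y) (star z)))
    (p := fun z => star (p (star z))) (q := fun z => star (q (star z)))
    (fun y z => by simp [h1]) (fun y z => by simp [h2]) (star y) (star z)
  simpa using h

/-- If `y ↦ a y` is a right multiplication, then `a` is real. -/
theorem eq_coe_of_mul_comm {a b : ℍ[ℝ]} (h : ∀ y, a * y = y * b) : a = (a.re : ℍ[ℝ]) ∧ b = a := by
  have hb : b = a := by simpa using (h 1).symm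
  subst hb
  have h1 := h qi
  have h2 := h qj
  rw [Quaternion.ext_iff] at h1 h2
  simp at h1 h2
  refine ⟨?_, rfl⟩
  ext <;> simp <;> linarith

/-- If every multiple `t T` is the sum of a left and a right multiplication, then `T` is a left
multiplication. -/
theorem eq_left_mul_of_mul_mem {T : ℍ[ℝ] → ℍ[ℝ]}
    (h : ∀ t, ∃ r m, ∀ y, t * T y = r * y + y * m) (y : ℍ[ℝ]) : T y = T 1 * y := by
  obtain ⟨r, m, h1⟩ := h 1
  obtain ⟨r', m', h2⟩ := h qi
  simp only [one_mul] at h1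
  simp only [h1] at h2
  -- `i T` is given both by `(r, m)` and by `(r', m')`, which is possible for real `m` only.
  have hm : m = (m.re : ℍ[ℝ]) := by
    have a1 := h2 1
    have a2 := h2 qi
    have a3 := h2 qj
    have a4 := h2 qk
    rw [Quaternion.ext_iff] at a1 a2 a3 a4
    simp at a1 a2 a3 a4
    ext <;> simp <;> linarith
  rw [h1, h1, hm, add_mul, mul_one, one_mul, Quaternion.coe_commutes]

/-- A real linear map which commutes with left multiplications up to a left multiplication is the
sum of a left and a right multiplication. The imaginary quaternion `r` is the solution of
`a = i r - r i`, `b = j r - r j`, `c = k r - r k`. -/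
theorem eq_left_mul_add_right_mul {a b c r : ℍ[ℝ]} {T : ℍ[ℝ] →ₗ[ℝ] ℍ[ℝ]}
    (h1 : ∀ y, qi * T y - T (qi * y) = a * y) (h2 : ∀ y, qj * T y - T (qj * y) = b * y)
    (h3 : ∀ y, qk * T y - T (qk * y) = c * y) (hr : r.re = 0) (hrI : r.imI = c.imJ / 2)
    (hrJ : r.imJ = a.imK / 2) (hrK : r.imK = b.imI / 2) (y : ℍ[ℝ]) :
    T y = y * (T 1 - r) + r * y := by
  have ii : qi * qi = -1 := by ext <;> simp
  have jj : qj * qj = -1 := by ext <;> simp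
  have kk : qk * qk = -1 := by ext <;> simp
  have ij : qi * qj = qk := by ext <;> simp
  have ji : qj * qi = -qk := by ext <;> simp
  have e1 : T qi = qi * T 1 - a := by
    have := h1 1
    rw [mul_one, mul_one] at this
    rw [← this]; abel
  have e2 : T qj = qj * T 1 - b := by
    have := h2 1
    rw [mul_one, mul_one] at this
    rw [← this]; abel
  have e3 : T qk = qk * T 1 - c := by
    have := h3 1
    rw [mul_one, mul_one] at this
    rw [← this]; abel
  -- The map `i ↦ a, j ↦ b, k ↦ c` is a derivation, hence inner.
  have r1 := h1 qi
  have r2 := h2 qj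
  have r3 := h3 qk
  have r4 := h1 qj
  have r5 := h2 qi
  rw [ii, map_neg, e1] at r1
  rw [jj, map_neg, e2] at r2
  rw [kk, map_neg, e3] at r3
  rw [ij, e2, e3] at r4
  rw [ji, map_neg, e1, e3] at r5
  have hy : y = y.re • 1 + y.imI • qi + y.imJ • qj + y.imK • qk := by ext <;> simp
  have hT : T y = y.re • T 1 + y.imI • (qi * T 1 - a) + y.imJ • (qj * T 1 - b)
      + y.imK • (qk * T 1 - c) := by
    conv_lhs => rw [hy]
    simp only [map_add, map_smul, e1, e2, e3]
  rw [hT]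
  obtain ⟨r11, r12, r13, r14⟩ := Quaternion.ext_iff.1 r1
  obtain ⟨r21, r22, r23, r24⟩ := Quaternion.ext_iff.1 r2
  obtain ⟨r31, r32, r33, r34⟩ := Quaternion.ext_iff.1 r3
  obtain ⟨r41, r42, r43, r44⟩ := Quaternion.ext_iff.1 r4
  obtain ⟨r51, r52, r53, r54⟩ := Quaternion.ext_iff.1 r5
  simp at r11 r12 r13 r14 r21 r22 r23 r24 r31 r32 r33 r34 r41 r42 r43 r44 r51 r52 r53 r54
  have a0 : a.re = 0 := by linarith
  have a1 : a.imI = 0 := by linarith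
  have b0 : b.re = 0 := by linarith
  have b2 : b.imJ = 0 := by linarith
  have c0 : c.re = 0 := by linarith
  have c3 : c.imK = 0 := by linarith
  have ab : a.imJ = -b.imI := by linarith
  have bc : b.imK = -c.imJ := by linarith
  have ac : c.imI = -a.imK := by linarith
  ext <;> simp [a0, a1, b0, b2, c0, c3, ab, bc, ac, hr, hrI, hrJ, hrK] <;> ring

/-! ### Directional derivatives -/

section Calculus

variable {E F : Type*} [NormedAddCommGroup E] [NormedSpace ℝ E] [NormedAddCommGroup F]
  [NormedSpace ℝ F]

/-- The derivative of `f` in the constant direction `w`. -/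
noncomputable def der (w : E) (f : E → F) (x : E) : F := fderiv ℝ f x w

theorem contDiff_der {f : E → F} (hf : ContDiff ℝ ∞ f) (w : E) : ContDiff ℝ ∞ (der w f) :=
  (hf.fderiv_right (m := ∞) (by simp)).clm_apply contDiff_const

theorem hasFDerivAt_of_contDiff {f : E → F} (hf : ContDiff ℝ ∞ f) (x : E) :
    HasFDerivAt f (fderiv ℝ f x) x :=
  (hf.differentiable (by simp) x).hasFDerivAt

theorem der_comm {f : E → F} (hf : ContDiff ℝ ∞ f) (w u : E) :
    der w (der u f) = der u (der w f) := by
  have key : ∀ (x w u : E), der w (der u f) x = fderiv ℝ (fderiv ℝ f) x w u := by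
    intro x w u
    have h1 := (hasFDerivAt_of_contDiff (hf.fderiv_right (m := ∞) (by simp)) x).clm_apply
      (hasFDerivAt_const u x)
    rw [der, show der u f = fun y => fderiv ℝ f y u from rfl, h1.fderiv]
    simp
  funext x
  rw [key, key]
  have h : IsSymmSndFDerivAt ℝ f x := (hf.contDiffAt).isSymmSndFDerivAt (by
    rw [minSmoothness_of_isRCLikeNormedField]; exact WithTop.coe_le_coe.2 (le_top : (2 : ℕ∞) ≤ ⊤))
  exact h.eq w u

theorem der_add {f g : E → F} (hf : ContDiff ℝ ∞ f) (hg : ContDiff ℝ ∞ g) (w x : E) :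
    der w (fun y => f y + g y) x = der w f x + der w g x :=
  congrArg (fun T => T w) ((hasFDerivAt_of_contDiff hf x).add (hasFDerivAt_of_contDiff hg x)).fderiv

theorem der_sub {f g : E → F} (hf : ContDiff ℝ ∞ f) (hg : ContDiff ℝ ∞ g) (w x : E) :
    der w (fun y => f y - g y) x = der w f x - der w g x :=
  congrArg (fun T => T w) ((hasFDerivAt_of_contDiff hf x).sub (hasFDerivAt_of_contDiff hg x)).fderiv

theorem der_const (c : F) (w x : E) : der w (fun _ : E => c) x = 0 := by
  simp [der]

theorem der_clm {f : E → F} {G : Type*} [NormedAddCommGroup G] [NormedSpace ℝ G]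
    (hf : ContDiff ℝ ∞ f) (L : F →L[ℝ] G) (w x : E) :
    der w (fun y => L (f y)) x = L (der w f x) :=
  congrArg (fun T => T w) (L.hasFDerivAt.comp x (hasFDerivAt_of_contDiff hf x)).fderiv

theorem der_const_mul {f : E → ℍ[ℝ]} (hf : ContDiff ℝ ∞ f) (c : ℍ[ℝ]) (w x : E) :
    der w (fun y => c * f y) x = c * der w f x :=
  der_clm hf (ContinuousLinearMap.mul ℝ ℍ[ℝ] c) w x

theorem der_mul_const {f : E → ℍ[ℝ]} (hf : ContDiff ℝ ∞ f) (c : ℍ[ℝ]) (w x : E) :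
    der w (fun y => f y * c) x = der w f x * c :=
  der_clm hf ((ContinuousLinearMap.mul ℝ ℍ[ℝ]).flip c) w x

theorem der_mul_right (c w x : ℍ[ℝ]) : der w (fun y => y * c) x = w * c := by
  have := der_mul_const (contDiff_id (𝕜 := ℝ) (n := ∞) (E := ℍ[ℝ])) c w x
  simpa [der] using this

theorem der_apply {n : ℕ} {V : E → Space n} (hV : ContDiff ℝ ∞ V) (a : Fin n) (w x : E) :
    der w (fun y => V y a) x = der w V x a :=
  der_clm hV (ContinuousLinearMap.proj (R := ℝ) (φ := fun _ : Fin n => ℍ[ℝ]) a) w x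

/-- The derivative is the linear coefficient of a polynomial expansion along a line. -/
theorem der_eq_of_expansion {f : E → F} {x w : E} {a b c : F} (hf : ContDiff ℝ ∞ f)
    (h : ∀ t : ℝ, f (x + t • w) = f x + t • a + t ^ 2 • b + t ^ 3 • c) : der w f x = a := by
  have h1 : HasDerivAt (fun t : ℝ => f (x + t • w)) (fderiv ℝ f x w) 0 := by
    have hl : HasDerivAt (fun t : ℝ => x + t • w) w 0 := by
      simpa using ((hasDerivAt_id (0 : ℝ)).smul_const w).const_add x
    have hf' : HasFDerivAt f (fderiv ℝ f x) (x + (0 : ℝ) • w) := by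
      simpa using hasFDerivAt_of_contDiff hf x
    exact hf'.comp_hasDerivAt 0 hl
  have h2 : HasDerivAt (fun t : ℝ => f x + t • a + t ^ 2 • b + t ^ 3 • c) a 0 := by
    have := ((((hasDerivAt_id (0 : ℝ)).smul_const a).const_add (f x)).add
      ((hasDerivAt_pow 2 (0 : ℝ)).smul_const b)).add ((hasDerivAt_pow 3 (0 : ℝ)).smul_const c)
    refine HasDerivAt.congr_deriv (f' := _) this ?_
    simp
  exact h1.unique (by simpa only [h] using h2)

/-- A function without derivative in the direction `w` is invariant under translation by `w`. -/
theorem eq_of_der_eq_zero {f : E → F} (hf : ContDiff ℝ ∞ f) {x w : E}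
    (h : ∀ y, der w f y = 0) : f (x + w) = f x := by
  have h1 : ∀ t : ℝ, HasDerivAt (fun t : ℝ => f (x + t • w)) 0 t := by
    intro t
    have hl : HasDerivAt (fun t : ℝ => x + t • w) w t := by
      simpa using ((hasDerivAt_id t).smul_const w).const_add x
    have := (hasFDerivAt_of_contDiff hf (x + t • w)).comp_hasDerivAt t hl
    rwa [show fderiv ℝ f (x + t • w) w = 0 from h _] at this
  have h2 := is_const_of_deriv_eq_zero (fun t => (h1 t).differentiableAt)
    (fun t => (h1 t).deriv) 1 0
  simpa using h2

theorem der_sum_single {n : ℕ} (f : Space n → F) (w x : Space n) :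
    der w f x = ∑ b, der (Pi.single b (w b)) f x := by
  conv_lhs => rw [← Finset.univ_sum_single w]
  simp only [der, map_sum]

theorem eq_of_forall_der_single_eq_zero {n : ℕ} {f : Space n → F} (hf : ContDiff ℝ ∞ f)
    {x x' : Space n} (h : ∀ b, x b ≠ x' b → ∀ y z, der (Pi.single b y) f z = 0) : f x = f x' := by
  have := eq_of_der_eq_zero hf (x := x') (w := x - x') fun z => by
    rw [der_sum_single]
    refine Finset.sum_eq_zero fun b _ => ?_
    by_cases hb : x b = x' b
    · simp [hb, der]
    · exact h b hb _ z
  simpa using this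

end Calculus

/-! ### The quadratic corrections -/

/-- The quadratic map `f_τ(x) = -⟨τ i, x⟩ x i - ½ x i x̄ τ i`: the correction in the coordinate `q₁`
which turns the translation by `τ` in the coordinate `q₀` into a symmetry. -/
noncomputable def quadMap (τ x : ℍ[ℝ]) : ℍ[ℝ] :=
  -(inner ℝ (τ * qi) x • (x * qi)) - (2 : ℝ)⁻¹ • (x * qi * star x * τ * qi)

/-- The right multiplication part of the derivative of `quadMap`. -/
noncomputable def quadCoeff (τ x : ℍ[ℝ]) : ℍ[ℝ] :=
  -(inner ℝ (τ * qi) x • qi) - qi * star x * τ * qi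

theorem contDiff_star_quaternion : ContDiff ℝ ∞ (star : ℍ[ℝ] → ℍ[ℝ]) := by
  have h : ContDiff ℝ ∞ (LinearMap.toContinuousLinearMap
      ({ toFun := star, map_add' := star_add, map_smul' := fun c x => by ext <;> simp } :
        ℍ[ℝ] →ₗ[ℝ] ℍ[ℝ])) :=
    ContinuousLinearMap.contDiff _
  exact h

theorem contDiff_quadMap (τ : ℍ[ℝ]) : ContDiff ℝ ∞ (quadMap τ) := by
  have h1 : ContDiff ℝ ∞ fun x : ℍ[ℝ] => inner ℝ (τ * qi) x := contDiff_const.inner ℝ contDiff_id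
  have h2 := contDiff_star_quaternion
  unfold quadMap
  fun_prop

theorem quadMap_zero (τ : ℍ[ℝ]) : quadMap τ 0 = 0 := by simp [quadMap]

theorem quadMap_zero_left (x : ℍ[ℝ]) : quadMap 0 x = 0 := by simp [quadMap]

theorem der_quadMap (τ y x : ℍ[ℝ]) : der y (quadMap τ) x
    = y * quadCoeff τ x - inner ℝ (τ * qi) y • (x * qi) - inner ℝ (x * qi) y • (τ * qi) := by
  refine der_eq_of_expansion (b := quadMap τ y) (c := 0) (contDiff_quadMap τ) fun t => ?_
  ext <;> simp [quadMap, quadCoeff, Quaternion.inner_def] <;> ring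

/-- The integrability conditions of `dg = y e(x) + (prescribed quadratic terms)` determine both the
admissible quadratic terms and the solution `g`. -/
theorem quadratic_integrability {g e : ℍ[ℝ] → ℍ[ℝ]} {τ η μ : ℍ[ℝ]} (hg : ContDiff ℝ ∞ g)
    (hη : η.re = 0)
    (h : ∀ x y, der y g x = y * e x - inner ℝ (τ * qi) y • (x * qi) - inner ℝ (x * qi) y • (τ * qi)
      - inner ℝ (x * η) y • (x * qi) + inner ℝ (x * qi) y • (x * μ)) :
    η = η.imI • qi ∧ μ = η.imI • qi ∧ ∃ e₀, ∀ x, g x = g 0 + x * e₀ + quadMap τ x := by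
  set g1 : ℍ[ℝ] → ℍ[ℝ] := fun x => g x - quadMap τ x with hg1
  have hg1s : ContDiff ℝ ∞ g1 := hg.sub (contDiff_quadMap τ)
  set k : ℍ[ℝ] → ℍ[ℝ] → ℍ[ℝ] := fun y x =>
    - (inner ℝ (x * η) y • (x * qi)) + inner ℝ (x * qi) y • (x * μ) with hk
  have hks : ∀ y, ContDiff ℝ ∞ (k y) := by
    intro y
    have i1 : ContDiff ℝ ∞ fun x : ℍ[ℝ] => inner ℝ (x * η) y :=
      (contDiff_id.mul contDiff_const).inner ℝ contDiff_const
    have i2 : ContDiff ℝ ∞ fun x : ℍ[ℝ] => inner ℝ (x * qi) y :=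
      (contDiff_id.mul contDiff_const).inner ℝ contDiff_const
    rw [hk]
    fun_prop
  set e1 : ℍ[ℝ] → ℍ[ℝ] := fun x => e x - quadCoeff τ x with he1
  have h1 : ∀ y x, der y g1 x = y * e1 x + k y x := by
    intro y x
    rw [hg1, der_sub hg (contDiff_quadMap τ), h, der_quadMap, he1, hk]
    simp only [mul_sub]
    abel
  have he1s : ContDiff ℝ ∞ e1 := by
    have : e1 = fun x => der 1 g1 x - k 1 x := by
      funext x
      rw [h1, one_mul, add_sub_cancel_right]
    rw [this]
    exact (contDiff_der hg1s 1).sub (hks 1)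
  have hdk : ∀ y z x, der z (k y) x = -(inner ℝ (z * η) y • (x * qi))
      - inner ℝ (x * η) y • (z * qi) + inner ℝ (z * qi) y • (x * μ)
      + inner ℝ (x * qi) y • (z * μ) := by
    intro y z x
    refine der_eq_of_expansion (b := k y z) (c := 0) (hks y) fun t => ?_
    simp only [hk, add_mul, smul_mul_assoc, inner_add_left, inner_smul_left]
    simp
    module
  have h2 : ∀ y z x, der z (der y g1) x = y * der z e1 x + der z (k y) x := by
    intro y z x
    rw [show der y g1 = fun x => y * e1 x + k y x from funext (h1 y),
      der_add (contDiff_const.mul he1s) (hks y), der_const_mul he1s]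
  -- Symmetry of the second derivatives of `g1` determines the derivative `p` of `e1`.
  set p : ℍ[ℝ] → ℍ[ℝ] → ℍ[ℝ] := fun z x => inner ℝ (x * qi) z • μ + qi * star z * x * μ
    - inner ℝ (x * η) z • qi - η * star z * x * qi with hp
  have h3 : ∀ z x, der z e1 x = p z x := by
    intro z x
    have key : ∀ y z, y * (der z e1 x - p z x) = z * (der y e1 x - p y x) := by
      intro y z
      have h4 : der z (der y g1) x = der y (der z g1) x := by rw [der_comm hg1s]
      rw [h2, h2, hdk, hdk] at h4
      have h5 : y * p z x + (-(inner ℝ (z * η) y • (x * qi))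
          - inner ℝ (x * η) y • (z * qi) + inner ℝ (z * qi) y • (x * μ)
          + inner ℝ (x * qi) y • (z * μ))
          = z * p y x + (-(inner ℝ (y * η) z • (x * qi))
          - inner ℝ (x * η) z • (y * qi) + inner ℝ (y * qi) z • (x * μ)
          + inner ℝ (x * qi) z • (y * μ)) := by
        simp only [hp]
        ext <;> simp [Quaternion.inner_def, hη] <;> ring
      have h6 := congrArg₂ (· - ·) h4 h5
      simp only [add_sub_add_right_eq_sub] at h6
      rwa [← mul_sub, ← mul_sub] at h6
    have := eq_zero_of_mul_left_symm (F := fun y z => y * (der z e1 x - p z x))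
      (fun y z => rfl) key 1 z
    rwa [one_mul, sub_eq_zero] at this
  have hps : ∀ z, ContDiff ℝ ∞ (p z) := fun z => by
    rw [← funext (h3 z)]
    exact contDiff_der he1s z
  have h4 : ∀ w z x, der w (p z) x = p z w := by
    intro w z x
    refine der_eq_of_expansion (b := 0) (c := 0) (hps z) fun t => ?_
    simp only [hp, add_mul, mul_add, smul_mul_assoc, mul_smul_comm, inner_add_left,
      inner_smul_left]
    simp
    module
  -- Symmetry of the second derivatives of `e1` then restricts `η` and `μ`.
  have h5 : ∀ w z, p z w = p w z := by
    intro w z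
    rw [← h4 w z 0, ← h4 z w 0, ← funext (h3 z), ← funext (h3 w), der_comm he1s]
  have h6 := h5 1 qi
  have h7 := h5 1 qj
  have hq : ‖qi‖ ^ 2 = 1 := by
    rw [pow_two, ← Quaternion.normSq_eq_norm_mul_self, Quaternion.normSq_def']
    simp
  have hη' : η = η.imI • qi ∧ μ = η.imI • qi := by
    simp only [hp] at h6 h7
    obtain ⟨a1, a2, a3, a4⟩ := Quaternion.ext_iff.1 h6
    obtain ⟨b1, b2, b3, b4⟩ := Quaternion.ext_iff.1 h7
    simp [Quaternion.inner_def, hη, hq] at a1 a2 a3 a4 b1 b2 b3 b4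
    constructor <;> ext <;> simp [hη] <;> linarith
  -- For these `η` and `μ` the additional quadratic terms cancel.
  refine ⟨hη'.1, hη'.2, e1 0, fun x => ?_⟩
  have hk0 : ∀ y x, k y x = 0 := by
    intro y x
    simp only [hk]
    rw [hη'.2]
    conv_lhs => rw [hη'.1]
    simp only [mul_smul_comm, inner_smul_left]
    simp
    module
  have hp0 : ∀ y x, p y x = 0 := by
    intro y x
    simp only [hp]
    rw [hη'.2]
    conv_lhs => rw [hη'.1]
    simp only [mul_smul_comm, smul_mul_assoc, inner_smul_left]
    simp
    module
  have he : ∀ x, e1 x = e1 0 := by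
    intro x
    have := eq_of_der_eq_zero he1s (x := 0) (w := x) fun y => by rw [h3, hp0]
    rwa [zero_add] at this
  have hL : ContDiff ℝ ∞ fun x : ℍ[ℝ] => x * e1 0 := contDiff_id.mul contDiff_const
  have hlast := eq_of_der_eq_zero (hg1s.sub hL) (x := 0) (w := x) fun y => by
    rw [der_sub hg1s hL, h1, hk0, he, der_mul_right]
    simp
  simp only [hg1, zero_add, zero_mul, sub_zero, quadMap_zero] at hlast
  rw [← hlast]
  abel

/-! ### The symmetry equations -/

/-- The index of the coordinate `q₀`. -/
abbrev i0 {n : ℕ} (hn : 2 ≤ n) : Fin n := ⟨0, by omega⟩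

/-- The index of the coordinate `q₁`. -/
abbrev i1 {n : ℕ} (hn : 2 ≤ n) : Fin n := ⟨1, by omega⟩

theorem i0_ne_i1 {n : ℕ} (hn : 2 ≤ n) : i0 hn ≠ i1 hn := by simp [i0, i1]

variable {n : ℕ}

theorem shear_apply (hn : 2 ≤ n) (x Y : Space n) : shear hn x Y
    = Pi.single (i1 hn) (inner ℝ (x (i0 hn) * qi) (Y (i0 hn)) • (x (i0 hn) * qi)) := rfl

theorem fderiv_shear_apply (hn : 2 ≤ n) (x w Y : Space n) : fderiv ℝ (shear hn) x w Y
    = Pi.single (i1 hn) (inner ℝ (w (i0 hn) * qi) (Y (i0 hn)) • (x (i0 hn) * qi)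
      + inner ℝ (x (i0 hn) * qi) (Y (i0 hn)) • (w (i0 hn) * qi)) := by
  have h1 := der_clm (contDiff_shear hn) (ContinuousLinearMap.apply ℝ (Space n) Y) w x
  have h2 : der w (fun y => shear hn y Y) x
      = Pi.single (i1 hn) (inner ℝ (w (i0 hn) * qi) (Y (i0 hn)) • (x (i0 hn) * qi)
      + inner ℝ (x (i0 hn) * qi) (Y (i0 hn)) • (w (i0 hn) * qi)) := by
    refine der_eq_of_expansion (b := shear hn w Y) (c := 0)
      ((contDiff_shear hn).clm_apply contDiff_const) fun t => ?_
    simp only [shear_apply, ← Pi.single_smul, ← Pi.single_add, smul_zero, add_zero]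
    congr 1
    simp only [Pi.add_apply, Pi.smul_apply, add_mul, smul_mul_assoc, inner_add_left,
      inner_smul_left]
    simp
    module
  exact h1.symm.trans h2

/-- With `B = 1 + A` and `C = 1 - A = B⁻¹`, the defect of `C L B` under the infinitesimal motion `T`
is the conjugate of a commutator with `L`. -/
theorem conj_commutator {R : Type*} [Ring R] {A A' L T : R} (h1 : A * A = 0) (h2 : A * A' = 0)
    (h3 : A' * A = 0) (h4 : A * (L * A') = 0) (h5 : A' * (L * A) = 0) :
    (L * A' - A' * L) - T * ((1 - A) * L * (1 + A)) + (1 - A) * L * (1 + A) * T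
      = (1 - A) * (L * (T + A' + A * T - T * A - A * T * A)
        - (T + A' + A * T - T * A - A * T * A) * L) * (1 + A) := by
  have BC : (1 + A) * (1 - A) = 1 := by simp [mul_sub, add_mul, h1]
  have CB : (1 - A) * (1 + A) = 1 := by simp [mul_add, sub_mul, h1]
  have h2' : ∀ X, A * (A' * X) = 0 := fun X => by rw [← mul_assoc, h2, zero_mul]
  have e1 : (1 - A) * (L * A' - A' * L) * (1 + A) = L * A' - A' * L := by
    simp [mul_sub, mul_add, sub_mul, mul_assoc, h2', h3, h4, h5]
  have e2 : T + A' + A * T - T * A - A * T * A = A' + (1 + A) * T * (1 - A) := by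
    simp only [add_mul, mul_sub, one_mul, mul_one]
    abel
  have e3 : (1 - A) * (L * ((1 + A) * T * (1 - A))) * (1 + A) = (1 - A) * L * (1 + A) * T := by
    calc _ = (1 - A) * L * (1 + A) * T * ((1 - A) * (1 + A)) := by simp only [mul_assoc]
      _ = _ := by rw [CB, mul_one]
  have e4 : (1 - A) * ((1 + A) * T * (1 - A) * L) * (1 + A) = T * ((1 - A) * L * (1 + A)) := by
    calc _ = (1 - A) * (1 + A) * (T * ((1 - A) * L * (1 + A))) := by simp only [mul_assoc]
      _ = _ := by rw [CB, one_mul]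
  have e5 : ∀ B C N : R, C * (L * (A' + N) - (A' + N) * L) * B
      = C * (L * A' - A' * L) * B + (C * (L * N) * B - C * (N * L) * B) := fun B C N => by
    simp only [mul_add, add_mul, mul_sub, sub_mul]
    abel
  rw [e2, e5, e1, e3, e4]
  abel

/-- The field `V` is an infinitesimal quaternionic symmetry of the model. -/
def IsSym (hn : 2 ≤ n) (V : Space n → Space n) : Prop :=
  ∃ h : ContDiff ℝ ∞ V, (⟨V, h⟩ : smoothFields (Space n)) ∈ modelSymmetries hn

/-- The endomorphism `(1 + A) (DV + D_V A) (1 - A)`, expanded. -/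
noncomputable def defect (hn : 2 ≤ n) (V : Space n → Space n) (x : Space n) :
    Space n →L[ℝ] Space n :=
  fderiv ℝ V x + fderiv ℝ (shear hn) x (V x) + shear hn x * fderiv ℝ V x
    - fderiv ℝ V x * shear hn x - shear hn x * fderiv ℝ V x * shear hn x

theorem conj_commutator_shear (hn : 2 ≤ n) (V : Space n → Space n) (x : Space n) (p : ℍ[ℝ]) :
    (leftMul n p * fderiv ℝ (shear hn) x (V x) - fderiv ℝ (shear hn) x (V x) * leftMul n p)
      - fderiv ℝ V x * complexStr hn p x + complexStr hn p x * fderiv ℝ V x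
    = (1 - shear hn x) * (leftMul n p * defect hn V x - defect hn V x * leftMul n p)
      * (1 + shear hn x) := by
  refine conj_commutator (shear_sq hn x) ?_ ?_ ?_ ?_ <;> ext1 Y
  · refine shear_eq_zero hn x _ ?_
    change fderiv ℝ (shear hn) x (V x) Y _ = 0
    rw [fderiv_shear_apply]
    simp
  · change fderiv ℝ (shear hn) x (V x) (shear hn x Y) = 0
    rw [fderiv_shear_apply, shear_apply_of_ne _ _ _ (by simp)]
    simp
  · refine shear_eq_zero hn x _ ?_
    change leftMul n p (fderiv ℝ (shear hn) x (V x) Y) _ = 0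
    rw [fderiv_shear_apply, leftMul_apply]
    simp
  · change fderiv ℝ (shear hn) x (V x) (leftMul n p (shear hn x Y)) = 0
    rw [fderiv_shear_apply, leftMul_apply, shear_apply_of_ne _ _ _ (by simp)]
    simp

theorem der_complexStr (hn : 2 ≤ n) (p : ℍ[ℝ]) (x w : Space n) :
    fderiv ℝ (complexStr hn p) x w
      = leftMul n p * fderiv ℝ (shear hn) x w - fderiv ℝ (shear hn) x w * leftMul n p := by
  have h1 := hasFDerivAt_of_contDiff (contDiff_shear hn) x
  have h2 := ((hasFDerivAt_const (leftMul n p) x).add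
    ((hasFDerivAt_const (leftMul n p) x).clm_comp h1)).sub
    (h1.clm_comp (hasFDerivAt_const (leftMul n p) x))
  have h3 : complexStr hn p = fun y => leftMul n p + (leftMul n p).comp (shear hn y)
        - (shear hn y).comp (leftMul n p) := funext fun y => complexStr_eq hn p y
  have h4 := congrArg (fun T => T w) h2.fderiv
  rw [h3]
  refine h4.trans ?_
  simp
  rfl

theorem contDiff_complexStr (hn : 2 ≤ n) (p : ℍ[ℝ]) : ContDiff ℝ ∞ (complexStr hn p) := by
  have h3 : complexStr hn p = fun y => leftMul n p + (leftMul n p).comp (shear hn y)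
        - (shear hn y).comp (leftMul n p) := funext fun y => complexStr_eq hn p y
  rw [h3]
  exact (contDiff_const.add (contDiff_const.clm_comp (contDiff_shear hn))).sub
    ((contDiff_shear hn).clm_comp contDiff_const)

/-- The symmetry condition, applied to the section `(1 - A) p (1 + A)` and conjugated by `1 + A`. -/
theorem IsSym.exists_commutator {hn : 2 ≤ n} {V : Space n → Space n} (hV : IsSym hn V)
    (x : Space n) {p : ℍ[ℝ]} (hp : p.re = 0) :
    ∃ p' : ℍ[ℝ], leftMul n p * defect hn V x - defect hn V x * leftMul n p = leftMul n p' := by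
  obtain ⟨hs, hV⟩ := hV
  have h := hV Set.univ isOpen_univ (complexStr hn p) (contDiff_complexStr hn p).contDiffOn
    (fun y _ => (mem_quatBundle hn y _).2 ⟨p, hp, rfl⟩) x (Set.mem_univ x)
  obtain ⟨p', -, h⟩ := (mem_quatBundle hn x _).1 h
  refine ⟨p', ?_⟩
  have h2 : lieDeriv V (complexStr hn p) x
      = fderiv ℝ (complexStr hn p) x (V x) - fderiv ℝ V x * complexStr hn p x
        + complexStr hn p x * fderiv ℝ V x := rfl
  change lieDeriv V (complexStr hn p) x = _ at h
  rw [h2, der_complexStr, conj_commutator_shear, complexStr] at h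
  have BC : (1 + shear hn x) * (1 - shear hn x) = 1 := by simp [mul_sub, add_mul, shear_sq]
  have h3 := congrArg (fun T => (1 + shear hn x) * T * (1 - shear hn x)) h
  simpa only [← mul_assoc, BC, one_mul, mul_assoc _ (1 + shear hn x), mul_one] using h3

/-- The entries of `defect` are right multiplications, up to a left multiplication on the
diagonal which is common to all diagonal entries. -/
theorem IsSym.exists_entries {hn : 2 ≤ n} {V : Space n → Space n} (hV : IsSym hn V)
    (x : Space n) : ∃ (r : ℍ[ℝ]) (G : Fin n → Fin n → ℍ[ℝ]), r.re = 0 ∧ ∀ a b y,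
      defect hn V x (Pi.single b y) a = y * G b a + if a = b then r * y else 0 := by
  obtain ⟨p1, h1⟩ := hV.exists_commutator x qi_re
  obtain ⟨p2, h2⟩ := hV.exists_commutator x qj_re
  obtain ⟨p3, h3⟩ := hV.exists_commutator x qk_re
  -- The derivation `i ↦ p1, j ↦ p2, k ↦ p3` is `p ↦ p r - r p`.
  obtain ⟨r, hr⟩ : ∃ r : ℍ[ℝ], r = ⟨0, p3.imJ / 2, p1.imK / 2, p2.imI / 2⟩ := ⟨_, rfl⟩
  set M := defect hn V x with hM
  let T : Fin n → Fin n → ℍ[ℝ] →ₗ[ℝ] ℍ[ℝ] := fun b a =>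
    { toFun := fun y => M (Pi.single b y) a
      map_add' := fun y z => by rw [Pi.single_add, map_add, Pi.add_apply]
      map_smul' := fun c y => by rw [Pi.single_smul, map_smul, Pi.smul_apply]; rfl }
  have key : ∀ {p p' : ℍ[ℝ]}, leftMul n p * M - M * leftMul n p = leftMul n p' →
      ∀ a b y, p * T b a y - T b a (p * y) = if a = b then p' * y else 0 := by
    intro p p' h a b y
    have h4 := congrFun (congrArg (fun S => S (Pi.single b y)) h) a
    have h5 : leftMul n p (Pi.single b y) = Pi.single b (p * y) := by
      funext c
      rw [leftMul_apply]
      by_cases hc : c = b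
      · subst hc; simp
      · simp [hc]
    have h6 : leftMul n p' (Pi.single b y) a = if a = b then p' * y else 0 := by
      rw [leftMul_apply]
      by_cases hc : a = b
      · subst hc; simp
      · simp [hc]
    rw [h6] at h4
    change p * M (Pi.single b y) a - M (leftMul n p (Pi.single b y)) a = _ at h4
    rwa [h5] at h4
  refine ⟨r, fun b a => T b a 1 - if a = b then r else 0, by rw [hr], fun a b y => ?_⟩
  by_cases hab : a = b
  · subst hab
    have := eq_left_mul_add_right_mul (T := T a a) (r := r) (fun y => by simpa using key h1 a a y)
      (fun y => by simpa using key h2 a a y) (fun y => by simpa using key h3 a a y)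
      (by rw [hr]) (by rw [hr]) (by rw [hr]) (by rw [hr]) y
    simpa using! this
  · have := eq_left_mul_add_right_mul (T := T b a) (a := 0) (b := 0) (c := 0) (r := 0)
      (fun y => by simpa [hab] using key h1 a b y) (fun y => by simpa [hab] using key h2 a b y)
      (fun y => by simpa [hab] using key h3 a b y) (by simp) (by simp) (by simp) (by simp) y
    simpa [hab] using! this

/-- A field is a symmetry as soon as its `defect` commutes with left multiplications up to
inner derivations. -/
theorem isSym_of_commutator (hn : 2 ≤ n) {V : Space n → Space n} (hV : ContDiff ℝ ∞ V)
    (h : ∀ x, ∃ r : ℍ[ℝ], ∀ p, leftMul n p * defect hn V x - defect hn V x * leftMul n p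
      = leftMul n (p * r - r * p)) : IsSym hn V := by
  refine ⟨hV, ?_⟩
  intro U hU s hs hsQ x hx
  have hUx : U ∈ nhds x := hU.mem_nhds hx
  -- A section of `Q` is `(1 - A) p (1 + A)` with a smooth function `p`, which is read off from an
  -- entry not affected by `A`.
  set p : Space n → ℍ[ℝ] := fun y => s y (Pi.single (i1 hn) 1) (i1 hn) with hp
  have hps : ∀ y ∈ U, (p y).re = 0 ∧ s y = complexStr hn (p y) y := by
    intro y hy
    obtain ⟨q, hq, hsq⟩ := (mem_quatBundle hn y _).1 (hsQ y hy)
    have : p y = q := by rw [hp]; simp only [hsq]; exact complexStr_single hn q y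
    rw [this]
    exact ⟨hq, hsq⟩
  have hpd : DifferentiableAt ℝ p x := by
    have h1 : ContDiffOn ℝ ∞ (fun y => s y (Pi.single (i1 hn) 1)) U :=
      hs.clm_apply contDiffOn_const
    exact differentiableAt_pi.1 ((h1.contDiffAt hUx).differentiableAt (by simp)) _
  have hre : (fderiv ℝ p x (V x)).re = 0 := by
    let reL : ℍ[ℝ] →L[ℝ] ℝ := innerSL ℝ (1 : ℍ[ℝ])
    have hreL : ∀ q : ℍ[ℝ], reL q = q.re := fun q => by simp [reL, Quaternion.inner_def]
    have e : (fun y => reL (p y)) =ᶠ[nhds x] fun _ => 0 := by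
      filter_upwards [hUx] with y hy
      rw [hreL, (hps y hy).1]
    have h1 := (reL.hasFDerivAt.comp x hpd.hasFDerivAt).unique
      ((hasFDerivAt_const (0 : ℝ) x).congr_of_eventuallyEq e)
    rw [← hreL]
    exact congrArg (fun L => L (V x)) h1
  have hA := hasFDerivAt_of_contDiff (contDiff_shear hn) x
  have hL : HasFDerivAt (fun y => leftMul n (p y)) ((leftMulL n).comp (fderiv ℝ p x)) x :=
    HasFDerivAt.comp (g := leftMulL n) x (leftMulL n).hasFDerivAt hpd.hasFDerivAt
  have e : s =ᶠ[nhds x] fun y =>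
      leftMul n (p y) + (leftMul n (p y)).comp (shear hn y)
        - (shear hn y).comp (leftMul n (p y)) := by
    filter_upwards [hUx] with y hy
    rw [(hps y hy).2, complexStr_eq]
    rfl
  have hsd := ((hL.add (hL.clm_comp hA)).sub (hA.clm_comp hL)).congr_of_eventuallyEq e
  have hsv : fderiv ℝ s x (V x)
      = complexStr hn (fderiv ℝ p x (V x)) x
        + (leftMul n (p x) * fderiv ℝ (shear hn) x (V x)
          - fderiv ℝ (shear hn) x (V x) * leftMul n (p x)) := by
    have : fderiv ℝ s x (V x) = leftMul n (fderiv ℝ p x (V x))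
        + (leftMul n (p x) * fderiv ℝ (shear hn) x (V x)
          + leftMul n (fderiv ℝ p x (V x)) * shear hn x)
        - (shear hn x * leftMul n (fderiv ℝ p x (V x))
          + fderiv ℝ (shear hn) x (V x) * leftMul n (p x)) := by
      rw [hsd.fderiv]
      rfl
    rw [this, complexStr_eq]
    abel
  obtain ⟨r, hr⟩ := h x
  refine (mem_quatBundle hn x _).2 ⟨fderiv ℝ p x (V x) + (p x * r - r * p x), ?_, ?_⟩
  · rw [Quaternion.re_add, hre]
    simp
    ring
  · have hlie : lieDeriv V s x = fderiv ℝ s x (V x) - fderiv ℝ V x * s x + s x * fderiv ℝ V x :=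
      rfl
    change lieDeriv V s x = _
    have h3 := conj_commutator_shear hn V x (p x)
    rw [hr] at h3
    have h4 : complexStr hn (fderiv ℝ p x (V x) + (p x * r - r * p x)) x
        = complexStr hn (fderiv ℝ p x (V x)) x + complexStr hn (p x * r - r * p x) x := by
      rw [complexStr, complexStr, complexStr, ← leftMulL_apply, map_add, mul_add (1 - shear hn x),
        add_mul _ _ (1 + shear hn x)]
      rfl
    rw [hlie, hsv, (hps x hx).2, h4, complexStr.eq_1 hn (p x * r - r * p x), ← h3]
    abel

theorem defect_apply (hn : 2 ≤ n) (V : Space n → Space n) (x Y : Space n) :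
    defect hn V x Y = fderiv ℝ V x Y + fderiv ℝ (shear hn) x (V x) Y
      + shear hn x (fderiv ℝ V x Y) - fderiv ℝ V x (shear hn x Y)
      - shear hn x (fderiv ℝ V x (shear hn x Y)) := rfl

/-- The derivative in the direction `y` of the coordinate `q_b`. -/
local notation:max "pd" b:max y:max => der (Pi.single b y : Space _)

theorem defect_single_of_ne (hn : 2 ≤ n) (V : Space n → Space n) (x : Space n) {b : Fin n}
    (hb : b ≠ i0 hn) (y : ℍ[ℝ]) (a : Fin n) :
    defect hn V x (Pi.single b y) a = pd b y V x a
      + if a = i1 hn then inner ℝ (x (i0 hn) * qi) (pd b y V x (i0 hn)) • (x (i0 hn) * qi)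
        else 0 := by
  have h1 : shear hn x (Pi.single b y) = 0 := shear_eq_zero hn x _ (by simp [hb.symm])
  have h2 : fderiv ℝ (shear hn) x (V x) (Pi.single b y) = 0 := by
    rw [fderiv_shear_apply]; simp [hb.symm]
  rw [defect_apply, h1, h2, shear_apply]
  by_cases ha : a = i1 hn
  · subst ha; simp [der]
  · simp [ha, der]

theorem defect_single_zero (hn : 2 ≤ n) (V : Space n → Space n) (x : Space n) (y : ℍ[ℝ])
    (a : Fin n) :
    defect hn V x (Pi.single (i0 hn) y) a = pd (i0 hn) y V x a
      - inner ℝ (x (i0 hn) * qi) y • pd (i1 hn) (x (i0 hn) * qi) V x a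
      + if a = i1 hn then
          inner ℝ (V x (i0 hn) * qi) y • (x (i0 hn) * qi)
          + inner ℝ (x (i0 hn) * qi) y • (V x (i0 hn) * qi)
          + inner ℝ (x (i0 hn) * qi) (pd (i0 hn) y V x (i0 hn)) • (x (i0 hn) * qi)
          - inner ℝ (x (i0 hn) * qi) y • inner ℝ (x (i0 hn) * qi)
            (pd (i1 hn) (x (i0 hn) * qi) V x (i0 hn)) • (x (i0 hn) * qi)
        else 0 := by
  have h1 : shear hn x (Pi.single (i0 hn) y)
      = inner ℝ (x (i0 hn) * qi) y • Pi.single (i1 hn) (x (i0 hn) * qi) := by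
    rw [shear_apply, Pi.single_eq_same, Pi.single_smul]
  rw [defect_apply, h1, fderiv_shear_apply, shear_apply, shear_apply, map_smul]
  by_cases ha : a = i1 hn
  · subst ha
    simp [der, inner_smul_right]
    module
  · simp [ha, der]

theorem fderiv_shear_eq_zero (hn : 2 ≤ n) (x w : Space n) (hw : w (i0 hn) = 0) :
    fderiv ℝ (shear hn) x w = 0 := by
  ext1 Y
  rw [fderiv_shear_apply, hw]
  simp

theorem IsSym.contDiff {hn : 2 ≤ n} {V : Space n → Space n} (hV : IsSym hn V) : ContDiff ℝ ∞ V :=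
  hV.1

theorem isSym_coe {hn : 2 ≤ n} {V : smoothFields (Space n)} (h : V ∈ modelSymmetries hn) :
    IsSym hn (V : Space n → Space n) :=
  ⟨contDiff_coe V, h⟩

theorem IsSym.lieBracket {hn : 2 ≤ n} {V W : Space n → Space n} (hV : IsSym hn V)
    (hW : IsSym hn W) : IsSym hn (VectorField.lieBracket ℝ V W) := by
  have h := isSym_coe ((modelSymmetries hn).lie_mem hV.2 hW.2)
  rw [coe_bracket] at h
  exact h

/-- Translations in the coordinates `q_b`, `b ≠ 0`, are symmetries. -/
theorem isSym_const (hn : 2 ≤ n) {w : Space n} (hw : w (i0 hn) = 0) : IsSym hn fun _ => w := by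
  refine isSym_of_commutator hn contDiff_const fun x => ⟨0, fun p => ?_⟩
  have h : defect hn (fun _ => w) x = 0 := by
    rw [defect, fderiv_shear_eq_zero hn x w hw]
    simp
  rw [h]
  ext1 Y
  funext a
  simp [leftMul_apply]

/-- The derivative of a symmetry in a direction transverse to `q₀` is its bracket with a
translation. -/
theorem IsSym.isSym_der {hn : 2 ≤ n} {V : Space n → Space n} (hV : IsSym hn V) {w : Space n}
    (hw : w (i0 hn) = 0) : IsSym hn (der w V) := by
  have h := (isSym_const hn hw).lieBracket hV
  have e : VectorField.lieBracket ℝ (fun _ => w) V = der w V := by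
    funext x
    simp [VectorField.lieBracket_eq, der]
  rwa [e] at h

theorem IsSym.isSym_pd {hn : 2 ≤ n} {V : Space n → Space n} (hV : IsSym hn V) {b : Fin n}
    (hb : b ≠ i0 hn) (y : ℍ[ℝ]) : IsSym hn (pd b y V) :=
  hV.isSym_der (by simp [hb.symm])

/-! ### Integration of the symmetry equations -/

/-- If the derivatives of `V_a` in the directions of `q_b` are `k(y) + y m` with `k` independent of
the point, then their derivatives are left linear in `y`. -/
theorem der_pd_eq_mul {V : Space n → Space n} (hV : ContDiff ℝ ∞ V) {b a : Fin n}
    {k : ℍ[ℝ] → ℍ[ℝ]} (h : ∀ x, ∃ m, ∀ y, pd b y V x a = k y + y * m) (w x : Space n) (y : ℍ[ℝ]) :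
    der w (pd b y V) x a = y * der w (pd b 1 V) x a := by
  have h1 : ∀ x, pd b y V x a = k y + y * (pd b 1 V x a - k 1) := by
    intro x
    obtain ⟨m, hm⟩ := h x
    rw [hm, hm]
    simp
  have hs : ∀ y, ContDiff ℝ ∞ fun x => pd b y V x a := fun y =>
    contDiff_pi.1 (contDiff_der hV (Pi.single b y)) a
  rw [← der_apply (contDiff_der hV (Pi.single b y)), funext h1,
    der_add contDiff_const (contDiff_const.mul ((hs 1).sub contDiff_const)),
    der_const_mul ((hs 1).sub contDiff_const), der_sub (hs 1) contDiff_const, der_const, der_const,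
    sub_zero, zero_add, der_apply (contDiff_der hV (Pi.single b 1))]

/-- A mixed second derivative which is left linear in both directions vanishes. -/
theorem pd_pd_apply_eq_zero {V : Space n → Space n} (hV : ContDiff ℝ ∞ V) {b c a : Fin n}
    {k l : ℍ[ℝ] → ℍ[ℝ]} (hb : ∀ x, ∃ m, ∀ y, pd b y V x a = k y + y * m)
    (hc : ∀ x, ∃ m, ∀ y, pd c y V x a = l y + y * m) (y z : ℍ[ℝ]) (x : Space n) :
    pd c z (pd b y V) x a = 0 := by
  refine eq_zero_of_mul_left_symm (F := fun y z => pd c z (pd b y V) x a)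
    (q := fun y => pd b y (pd c 1 V) x a) (fun y z => der_pd_eq_mul hV hb _ x y) (fun y z => ?_) y z
  change der _ (der _ V) x a = _
  rw [der_comm hV]
  exact der_pd_eq_mul hV hc _ x z

section

variable {hn : 2 ≤ n} {V : Space n → Space n}

theorem IsSym.pd_zero_comp (hV : IsSym hn V) {b : Fin n} (hb : b ≠ i0 hn) (x : Space n) :
    ∃ m, ∀ y, pd b y V x (i0 hn) = 0 + y * m := by
  obtain ⟨r, G, -, h⟩ := hV.exists_entries x
  refine ⟨G b (i0 hn), fun y => ?_⟩
  have := h (i0 hn) b y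
  rw [defect_single_of_ne hn V x hb, if_neg (i0_ne_i1 hn), if_neg hb.symm] at this
  rw [zero_add]
  simpa using this

theorem IsSym.pd_pd_zero_comp (hV : IsSym hn V) {b c : Fin n} (hb : b ≠ i0 hn) (hc : c ≠ i0 hn)
    (y z : ℍ[ℝ]) (x : Space n) :
    pd c z (pd b y V) x (i0 hn) = 0 :=
  pd_pd_apply_eq_zero (k := fun _ => 0) (l := fun _ => 0) hV.contDiff (hV.pd_zero_comp hb)
    (hV.pd_zero_comp hc) y z x


theorem contDiff_apply_comp (hV : ContDiff ℝ ∞ V) (a : Fin n) : ContDiff ℝ ∞ fun x => V x a :=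
  contDiff_pi.1 hV a

theorem contDiff_coord (a : Fin n) : ContDiff ℝ ∞ fun x : Space n => x a :=
  contDiff_apply ℝ ℍ[ℝ] a

theorem pd_coord (b a : Fin n) (y : ℍ[ℝ]) (x : Space n) :
    pd b y (fun x : Space n => x a) x = (Pi.single b y : Space n) a := by
  have := der_apply (contDiff_id (𝕜 := ℝ) (n := ∞) (E := Space n)) a (Pi.single b y) x
  simpa [der] using this

/-- If a component of a smooth field vanishes identically, so do its derivatives. -/
theorem der_apply_eq_zero (hV : ContDiff ℝ ∞ V) {a : Fin n} (h : ∀ x, V x a = 0) (w x : Space n) :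
    der w V x a = 0 := by
  rw [← der_apply hV, funext h, der_const]

/-- The derivatives of the component `V₀` in the direction `q_d`, `d ≠ 0`, are
`t (c_d + s_d q₀)`. -/
theorem IsSym.exists_transverse (hV : IsSym hn V) {d : Fin n} (hd : d ≠ i0 hn) :
    ∃ c s : ℍ[ℝ], ∀ t x, pd d t V x (i0 hn) = t * (c + s * x (i0 hn)) := by
  have hU := hV.isSym_pd hd 1
  have e1 : ∀ w x t, der w (pd d t V) x (i0 hn) = t * der w (pd d 1 V) x (i0 hn) := fun w x t =>
    der_pd_eq_mul (k := fun _ => 0) hV.contDiff (hV.pd_zero_comp hd) w x t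
  have e2 : ∀ x y, pd (i0 hn) y (pd d 1 V) x (i0 hn)
      = pd (i0 hn) 1 (pd d 1 V) x (i0 hn) * y := by
    intro x
    refine eq_left_mul_of_mul_mem (T := fun y => pd (i0 hn) y (pd d 1 V) x (i0 hn)) fun t => ?_
    obtain ⟨r, G, -, h⟩ := (hV.isSym_pd hd t).exists_entries x
    refine ⟨r, G (i0 hn) (i0 hn), fun y => ?_⟩
    have := h (i0 hn) (i0 hn) y
    rw [defect_single_zero, if_neg (i0_ne_i1 hn),
      hV.pd_pd_zero_comp hd (i0_ne_i1 hn).symm t _ x, e1] at this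
    rw [add_comm]
    simpa using this
  have hUs := hU.contDiff
  have hs := contDiff_apply_comp (contDiff_der hUs (Pi.single (i0 hn) 1)) (i0 hn)
  have e3 : ∀ x, pd (i0 hn) 1 (pd d 1 V) x (i0 hn) = pd (i0 hn) 1 (pd d 1 V) 0 (i0 hn) := by
    intro x
    refine eq_of_forall_der_single_eq_zero hs fun b _ z x => ?_
    rw [der_apply (contDiff_der hUs _)]
    by_cases hb : b = i0 hn
    · subst hb
      have e4 : ∀ y z, pd (i0 hn) z (pd (i0 hn) y (pd d 1 V)) x (i0 hn)
          = pd (i0 hn) z (pd (i0 hn) 1 (pd d 1 V)) x (i0 hn) * y := by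
        intro y z
        rw [← der_apply (contDiff_der hUs _), funext fun x => e2 x y, der_mul_const hs,
          der_apply (contDiff_der hUs _)]
      refine eq_zero_of_mul_right_symm
        (F := fun y z => pd (i0 hn) z (pd (i0 hn) y (pd d 1 V)) x (i0 hn))
        (q := fun y => pd (i0 hn) y (pd (i0 hn) 1 (pd d 1 V)) x (i0 hn)) e4 (fun y z => ?_) 1 z
      rw [der_comm hUs]
      exact e4 z y
    · rw [der_comm hUs]
      exact der_apply_eq_zero (contDiff_der hUs _)
        (fun x => hV.pd_pd_zero_comp hd hb 1 z x) _ _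
  refine ⟨pd d 1 V 0 (i0 hn), pd (i0 hn) 1 (pd d 1 V) 0 (i0 hn), fun t x => ?_⟩
  have hx0 : pd d t V x (i0 hn) = t * pd d 1 V x (i0 hn) := by
    obtain ⟨m, hm⟩ := hV.pd_zero_comp hd x
    simp [hm]
  rw [hx0]
  congr 1
  set s := pd (i0 hn) 1 (pd d 1 V) 0 (i0 hn) with hsdef
  have hc := contDiff_coord (i0 hn)
  have := eq_of_forall_der_single_eq_zero
    ((contDiff_apply_comp hUs (i0 hn)).sub (contDiff_const (c := s) |>.mul hc)) (x := x) (x' := 0)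
    fun b _ z x => by
      rw [der_sub (contDiff_apply_comp hUs (i0 hn)) (contDiff_const.mul hc), der_const_mul hc,
        der_apply hUs, pd_coord]
      by_cases hb : b = i0 hn
      · subst hb
        rw [e2, e3]
        simp [s]
      · rw [hV.pd_pd_zero_comp hd hb]
        simp [Ne.symm hb]
  rw [← sub_eq_iff_eq_add, this]
  simp

theorem pd_zero_of_transverse (hV : ContDiff ℝ ∞ V) {d : Fin n} {c s : ℍ[ℝ]}
    (hcs : ∀ t x, pd d t V x (i0 hn) = t * (c + s * x (i0 hn))) (t y : ℍ[ℝ]) (x : Space n) :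
    pd (i0 hn) y (pd d t V) x (i0 hn) = t * s * y := by
  have hc := contDiff_coord (i0 hn)
  rw [← der_apply (contDiff_der hV _), funext (hcs t),
    der_const_mul (contDiff_const.add (contDiff_const.mul hc)),
    der_add contDiff_const (contDiff_const.mul hc), der_const, der_const_mul hc, pd_coord]
  simp [mul_assoc]

/-- For the derivative `W` of a symmetry in the direction `q_d`, `d ≠ 0`, the common left
multiplication is `t s_d`. -/
theorem IsSym.pd_pd_apply (hV : IsSym hn V) {d : Fin n} (hd : d ≠ i0 hn) {c s : ℍ[ℝ]}
    (hcs : ∀ t x, pd d t V x (i0 hn) = t * (c + s * x (i0 hn))) {b a : Fin n} (hb : b ≠ i0 hn)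
    (t : ℍ[ℝ]) (x : Space n) :
    ∃ m, ∀ y, pd b y (pd d t V) x a = (if a = b then t * s * y else 0) + y * m := by
  obtain ⟨r, G, -, h⟩ := (hV.isSym_pd hd t).exists_entries x
  obtain ⟨h1, -⟩ := eq_coe_of_mul_comm (a := t * s - r) (b := G (i0 hn) (i0 hn)) fun y => by
    have := h (i0 hn) (i0 hn) y
    rw [defect_single_zero, if_neg (i0_ne_i1 hn),
      hV.pd_pd_zero_comp hd (i0_ne_i1 hn).symm t _ x, pd_zero_of_transverse hV.contDiff hcs,
      if_pos rfl] at this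
    rw [sub_mul, sub_eq_iff_eq_add]
    simpa using this
  have h2 : ∀ y, pd b y (pd d t V) x a = y * G b a + if a = b then r * y else 0 := by
    intro y
    have := h a b y
    rw [defect_single_of_ne hn _ x hb, hV.pd_pd_zero_comp hd hb t y x] at this
    simpa using this
  by_cases hab : a = b
  · refine ⟨G b a - (t * s - r), fun y => ?_⟩
    have h3 : (t * s - r) * y = y * (t * s - r) := by
      rw [h1, Quaternion.coe_commutes]
    rw [h2, if_pos hab, if_pos hab, mul_sub, ← h3, sub_mul]
    abel
  · exact ⟨G b a, fun y => by rw [h2, if_neg hab, if_neg hab, add_comm]⟩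

/-- The second derivatives of a symmetry in the directions `q_b`, `b ≠ 0`, are constant. -/
theorem IsSym.pd_pd_const (hV : IsSym hn V) {b d : Fin n} (hd : d ≠ i0 hn) (hb : b ≠ i0 hn)
    (t y : ℍ[ℝ]) (x : Space n) : pd b y (pd d t V) x = pd b y (pd d t V) 0 := by
  obtain ⟨c, s, hcs⟩ := hV.exists_transverse hd
  have hW := hV.isSym_pd hd t
  have hU := hW.isSym_pd hb y
  have hU0 : ∀ x, pd b y (pd d t V) x (i0 hn) = 0 := hV.pd_pd_zero_comp hd hb t y
  have e1 : ∀ e, e ≠ i0 hn → ∀ z x, pd e z (pd b y (pd d t V)) x = 0 := by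
    intro e he z x
    funext a
    by_cases ha : a = i0 hn
    · subst ha
      exact hW.pd_pd_zero_comp hb he y z x
    · exact pd_pd_apply_eq_zero hW.contDiff (hV.pd_pd_apply hd hcs hb t)
        (hV.pd_pd_apply hd hcs he t) y z x
  refine eq_of_forall_der_single_eq_zero hU.contDiff fun e _ z x => ?_
  by_cases he : e = i0 hn
  · subst he
    funext a
    by_cases ha : a = i0 hn
    · subst ha
      exact der_apply_eq_zero hU.contDiff hU0 _ _
    · refine eq_zero_of_mul_left_symm
        (F := fun y z => pd (i0 hn) z (pd b y (pd d t V)) x a)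
        (q := fun y => pd (i0 hn) 1 (pd b y (pd d t V)) x a)
        (fun y z => der_pd_eq_mul hW.contDiff (hV.pd_pd_apply hd hcs hb t) _ x y)
        (fun y z => ?_) y z
      have hU := hW.isSym_pd hb y
      have hU0 : ∀ x, pd b y (pd d t V) x (i0 hn) = 0 := hV.pd_pd_zero_comp hd hb t y
      have e1 : ∀ z x, pd (i1 hn) z (pd b y (pd d t V)) x a = 0 := fun z x =>
        pd_pd_apply_eq_zero hW.contDiff (hV.pd_pd_apply hd hcs hb t)
          (hV.pd_pd_apply hd hcs (i0_ne_i1 hn).symm t) y z x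
      have e2 : ∀ z x, pd (i1 hn) z (pd b y (pd d t V)) x (i0 hn) = 0 := fun z x =>
        hW.pd_pd_zero_comp hb (i0_ne_i1 hn).symm y z x
      have e3 : ∀ z x, pd (i0 hn) z (pd b y (pd d t V)) x (i0 hn) = 0 := fun z x =>
        der_apply_eq_zero hU.contDiff hU0 _ _
      obtain ⟨r, G, -, h⟩ := hU.exists_entries x
      have e4 : ∀ z, pd (i0 hn) z (pd b y (pd d t V)) x a = z * G (i0 hn) a := by
        intro z
        have := h a (i0 hn) z
        rw [defect_single_zero, e1, e2, e3, hU0, if_neg ha] at this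
        simpa using this
      simp only [e4, one_mul]
  · exact e1 e he z x

theorem der_comp_single (hV : ContDiff ℝ ∞ V) (b : Fin n) (a : Fin n) (y x : ℍ[ℝ]) :
    der y (fun x => V (Pi.single b x) a) x = pd b y V (Pi.single b x) a := by
  have h1 : HasFDerivAt (fun x : ℍ[ℝ] => (Pi.single b x : Space n))
      (ContinuousLinearMap.single ℝ (fun _ : Fin n => ℍ[ℝ]) b) x :=
    (ContinuousLinearMap.single ℝ (fun _ : Fin n => ℍ[ℝ]) b).hasFDerivAt
  have h2 := ((hasFDerivAt_of_contDiff (contDiff_apply_comp hV a) (Pi.single b x)).comp x h1).fderiv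
  exact (congrArg (fun T => T y) h2).trans (der_apply hV a _ _)

theorem contDiff_comp_single (hV : ContDiff ℝ ∞ V) (b a : Fin n) :
    ContDiff ℝ ∞ fun x : ℍ[ℝ] => V (Pi.single b x) a :=
  (contDiff_apply_comp hV a).comp
    (ContinuousLinearMap.single ℝ (fun _ : Fin n => ℍ[ℝ]) b).contDiff

/-- Integration of the equation for the second component of the derivative of a symmetry in the
direction `q_d`, `d ≠ 0`. -/
theorem IsSym.pd_second_comp (hV : IsSym hn V) {d : Fin n} (hd : d ≠ i0 hn) {c s : ℍ[ℝ]}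
    (hcs : ∀ t x, pd d t V x (i0 hn) = t * (c + s * x (i0 hn))) (t : ℍ[ℝ]) :
    (∀ y x, pd (i1 hn) y (pd d t V) x (i1 hn) = t * s * y + y * (2 * (t * s).re : ℝ)) ∧
    ∃ e, ∀ x, pd d t V (Pi.single (i0 hn) x) (i1 hn)
      = pd d t V 0 (i1 hn) + x * e + quadMap (t * c) x := by
  have h10 := (i0_ne_i1 hn).symm
  have hW := hV.isSym_pd hd t
  obtain ⟨m, hm⟩ := hV.pd_pd_apply hd hcs h10 t 0
  have hm' : ∀ y x, pd (i1 hn) y (pd d t V) x (i1 hn) = t * s * y + y * m := by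
    intro y x
    rw [hV.pd_pd_const hd h10, hm, if_pos rfl]
  have key : ∀ x : ℍ[ℝ], ∃ e, ∀ y, pd (i0 hn) y (pd d t V) (Pi.single (i0 hn) x) (i1 hn)
      = y * e - inner ℝ (t * c * qi) y • (x * qi) - inner ℝ (x * qi) y • (t * c * qi)
      - inner ℝ (x * 0) y • (x * qi)
      + inner ℝ (x * qi) y • (x * (qi * (m - (2 * (t * s).re : ℝ)))) := by
    intro x
    obtain ⟨r, G, -, h⟩ := hW.exists_entries (Pi.single (i0 hn) x)
    refine ⟨G (i0 hn) (i1 hn), fun y => ?_⟩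
    have h1 := h (i1 hn) (i0 hn) y
    rw [defect_single_zero, if_pos rfl, if_neg h10, hm', hcs, pd_zero_of_transverse hV.contDiff hcs,
      hV.pd_pd_zero_comp hd h10, inner_zero_right, zero_smul, smul_zero, sub_zero, add_zero,
      Pi.single_eq_same] at h1
    have h2 : ∀ σ : ℍ[ℝ], inner ℝ (σ * x * qi) y + inner ℝ (x * qi) (σ * y)
        = 2 * σ.re * inner ℝ (x * qi) y := by
      intro σ
      simp [Quaternion.inner_def]
      ring
    have h3 := h2 (t * s)
    have hcoe : ∀ u : ℍ[ℝ], u * ((2 * (t * s).re : ℝ) : ℍ[ℝ]) = (2 * (t * s).re) • u := fun u => by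
      rw [← Quaternion.coe_commutes, Quaternion.coe_mul_eq_smul]
    rw [← h1]
    simp only [mul_add, add_mul, inner_add_left, ← mul_assoc, mul_sub, hcoe, mul_smul_comm,
      mul_zero, inner_zero_left, zero_smul] at h3 ⊢
    rw [show inner ℝ (t * s * x * qi) y
      = 2 * (t * s).re * inner ℝ (x * qi) y - inner ℝ (x * qi) (t * s * y) by linarith]
    module
  choose e he using key
  have hq := quadratic_integrability (g := fun x => pd d t V (Pi.single (i0 hn) x) (i1 hn))
    (e := e) (τ := t * c) (η := 0) (μ := qi * (m - (2 * (t * s).re : ℝ)))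
    (contDiff_comp_single hW.contDiff _ _) (by simp)
    (fun x y => by rw [der_comp_single hW.contDiff]; exact he x y)
  obtain ⟨-, h2, e0, h3⟩ := hq
  have h4 : m = (2 * (t * s).re : ℝ) := by
    have : qi * (m - (2 * (t * s).re : ℝ)) = 0 := by simpa using h2
    rcases mul_eq_zero.1 this with h | h
    · exact absurd (congrArg QuaternionAlgebra.imI h) (by simp)
    · exact sub_eq_zero.1 h
  refine ⟨fun y x => by rw [hm', h4], e0, fun x => ?_⟩
  have := h3 x
  simpa using this


/-- Symmetry of second derivatives excludes the slope `s_d`. -/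
theorem IsSym.slope_eq_zero (hV : IsSym hn V) {d : Fin n} (hd : d ≠ i0 hn) {c s : ℍ[ℝ]}
    (hcs : ∀ t x, pd d t V x (i0 hn) = t * (c + s * x (i0 hn))) : s = 0 := by
  have h10 := (i0_ne_i1 hn).symm
  have h1 : ∀ t y, t * s * y + y * (2 * (t * s).re : ℝ) = pd d t (pd (i1 hn) y V) 0 (i1 hn) := by
    intro t y
    rw [← (hV.pd_second_comp hd hcs t).1 y 0, der_comm hV.contDiff]
  by_cases hd1 : i1 hn = d
  · subst hd1
    have h2 : ∀ t y, t * s * y + y * (2 * (t * s).re : ℝ)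
        = y * s * t + t * (2 * (y * s).re : ℝ) := fun t y => by
      rw [h1, (hV.pd_second_comp hd hcs y).1]
    obtain ⟨a1, a2, a3, a4⟩ := Quaternion.ext_iff.1 (h2 qi 1)
    obtain ⟨b1, b2, b3, b4⟩ := Quaternion.ext_iff.1 (h2 qj 1)
    obtain ⟨c1, c2, c3, c4⟩ := Quaternion.ext_iff.1 (h2 qk 1)
    simp at a1 a2 a3 a4 b1 b2 b3 b4 c1 c2 c3 c4
    ext <;> simp <;> linarith
  · obtain ⟨c', s', hcs'⟩ := hV.exists_transverse h10
    obtain ⟨m, hm⟩ := hV.pd_pd_apply h10 hcs' (a := i1 hn) hd 1 0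
    have h2 : ∀ t, t * s * 1 + 1 * (2 * (t * s).re : ℝ) = t * m := fun t => by
      rw [h1, hm, if_neg hd1, zero_add]
    obtain ⟨d1, d2, d3, d4⟩ := Quaternion.ext_iff.1 (h2 1)
    obtain ⟨a1, a2, a3, a4⟩ := Quaternion.ext_iff.1 (h2 qi)
    obtain ⟨b1, b2, b3, b4⟩ := Quaternion.ext_iff.1 (h2 qj)
    obtain ⟨c1, c2, c3, c4⟩ := Quaternion.ext_iff.1 (h2 qk)
    simp at a1 a2 a3 a4 b1 b2 b3 b4 c1 c2 c3 c4 d1 d2 d3 d4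
    ext <;> simp <;> linarith

/-- A symmetry is affine in the coordinates `q_b`, `b ≠ 0`. -/
theorem IsSym.pd_pd_eq_zero (hV : IsSym hn V) {b d : Fin n} (hd : d ≠ i0 hn) (hb : b ≠ i0 hn)
    (t y : ℍ[ℝ]) (x : Space n) : pd b y (pd d t V) x = 0 := by
  obtain ⟨c, s, hcs⟩ := hV.exists_transverse hd
  obtain ⟨c', s', hcs'⟩ := hV.exists_transverse hb
  have hs := hV.slope_eq_zero hd hcs
  have hs' := hV.slope_eq_zero hb hcs'
  subst hs hs'
  funext a
  have h1 : ∀ t y, pd b y (pd d t V) x a = y * pd b 1 (pd d t V) x a := by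
    intro t y
    obtain ⟨m, hm⟩ := hV.pd_pd_apply hd hcs (a := a) hb t x
    simp [hm]
  have h2 : ∀ t y, pd b y (pd d t V) x a = t * pd d 1 (pd b y V) x a := by
    intro t y
    obtain ⟨m, hm⟩ := hV.pd_pd_apply hb hcs' (a := a) hd y x
    rw [der_comm hV.contDiff]
    simp [hm]
  exact eq_zero_of_mul_left_symm (F := fun t y => pd b y (pd d t V) x a)
    (p := fun y => pd d 1 (pd b y V) x a) (q := fun t => pd b 1 (pd d t V) x a) h2 h1 t y

/-- The component `V₀` of a symmetry depends on `q₀` only. -/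
theorem IsSym.pd_apply_zero (hV : IsSym hn V) {d : Fin n} (hd : d ≠ i0 hn)
    (t : ℍ[ℝ]) (x : Space n) : pd d t V x (i0 hn) = 0 := by
  obtain ⟨c, s, hcs⟩ := hV.exists_transverse hd
  have hs := hV.slope_eq_zero hd hcs
  subst hs
  have h1 : ∀ x : ℍ[ℝ], ∃ r m : ℍ[ℝ], ∀ t, pd d t V (Pi.single (i0 hn) x) (i1 hn)
      = r * t + t * m - inner ℝ (x * qi) (t * c) • (x * qi) := by
    intro x
    obtain ⟨r, G, -, h⟩ := hV.exists_entries (Pi.single (i0 hn) x)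
    refine ⟨if i1 hn = d then r else 0, G d (i1 hn), fun t => ?_⟩
    have := h (i1 hn) d t
    rw [defect_single_of_ne hn V _ hd, if_pos rfl, hcs, Pi.single_eq_same, zero_mul, add_zero]
      at this
    rw [eq_sub_iff_add_eq, this, ite_mul, zero_mul, add_comm]
  -- The second difference in `x` isolates the quadratic part of the field.
  have h2 : ∃ r m : ℍ[ℝ], ∀ t, (2 : ℝ) • quadMap (t * c) 1
      = r * t + t * m - (2 : ℝ) • inner ℝ qi (t * c) • qi := by
    obtain ⟨r0, m0, h0⟩ := h1 0
    obtain ⟨r1, m1, hp⟩ := h1 1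
    obtain ⟨r2, m2, hm⟩ := h1 (-1)
    refine ⟨r1 + r2 - (2 : ℝ) • r0, m1 + m2 - (2 : ℝ) • m0, fun t => ?_⟩
    obtain ⟨e, he⟩ := (hV.pd_second_comp hd hcs t).2
    have e0 := h0 t
    have e1 := hp t
    have e2 := hm t
    rw [he] at e0 e1 e2
    have h3 : quadMap (t * c) (-1) = quadMap (t * c) 1 := by simp [quadMap]
    rw [quadMap_zero] at e0
    rw [h3] at e2
    have h4 : (2 : ℝ) • quadMap (t * c) 1
        = (pd d t V 0 (i1 hn) + 1 * e + quadMap (t * c) 1)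
          + (pd d t V 0 (i1 hn) + -1 * e + quadMap (t * c) 1)
          - (2 : ℝ) • (pd d t V 0 (i1 hn) + 0 * e + 0) := by
      rw [zero_mul, one_mul, neg_one_mul]
      module
    rw [h4, e0, e1, e2]
    simp only [neg_mul, one_mul, inner_neg_left, zero_mul, smul_zero, sub_zero, add_mul, sub_mul,
      mul_add, mul_sub, smul_mul_assoc, mul_smul_comm]
    module
  have hc : c = 0 := by
    obtain ⟨r, m, h⟩ := h2
    obtain ⟨d1, d2, d3, d4⟩ := Quaternion.ext_iff.1 (h 1)
    obtain ⟨a1, a2, a3, a4⟩ := Quaternion.ext_iff.1 (h qi)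
    obtain ⟨b1, b2, b3, b4⟩ := Quaternion.ext_iff.1 (h qj)
    obtain ⟨c1, c2, c3, c4⟩ := Quaternion.ext_iff.1 (h qk)
    simp [quadMap, Quaternion.inner_def] at a1 a2 a3 a4 b1 b2 b3 b4 c1 c2 c3 c4 d1 d2 d3 d4
    ext <;> simp <;> linarith
  simp [hcs, hc]

/-- The mixed second derivatives of a symmetry are constant, and left linear in the direction
of `q₀`. -/
theorem IsSym.pd_pd_i0 (hV : IsSym hn V) {d : Fin n} (hd : d ≠ i0 hn) {a : Fin n} (ha : a ≠ i0 hn)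
    (t y : ℍ[ℝ]) (x : Space n) :
    pd (i0 hn) y (pd d t V) x a = y * pd (i0 hn) 1 (pd d t V) 0 a := by
  have h10 := (i0_ne_i1 hn).symm
  have hW := hV.isSym_pd hd t
  have h1 : ∀ x, ∃ m, ∀ y, pd (i0 hn) y (pd d t V) x a = 0 + y * m := by
    intro x
    obtain ⟨r, G, -, h⟩ := hW.exists_entries x
    refine ⟨G (i0 hn) a, fun y => ?_⟩
    have := h a (i0 hn) y
    rw [defect_single_zero, hV.pd_pd_eq_zero hd h10, hV.pd_apply_zero hd,
      der_apply_eq_zero hW.contDiff (hV.pd_apply_zero hd t), if_neg ha] at this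
    simpa using this
  have h2 : pd (i0 hn) y (pd d t V) x a = pd (i0 hn) y (pd d t V) 0 a := by
    refine eq_of_forall_der_single_eq_zero
      (contDiff_apply_comp (contDiff_der hW.contDiff _) a) fun b _ z x => ?_
    rw [der_apply (contDiff_der hW.contDiff _)]
    by_cases hb : b = i0 hn
    · subst hb
      exact pd_pd_apply_eq_zero (k := fun _ => 0) (l := fun _ => 0) hW.contDiff h1 h1 y z x
    · rw [der_comm hW.contDiff, funext (hV.pd_pd_eq_zero hd hb t z)]
      simp [der_const]
  obtain ⟨m, hm⟩ := h1 0
  rw [h2, hm, hm]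
  simp

/-- The derivatives of a symmetry in the directions `q_b`, `b ≠ 0`, depend on `q₀` only. -/
theorem IsSym.pd_eq (hV : IsSym hn V) {d : Fin n} (hd : d ≠ i0 hn) {a : Fin n} (ha : a ≠ i0 hn)
    (t : ℍ[ℝ]) (x : Space n) :
    pd d t V x a = pd d t V 0 a + x (i0 hn) * pd (i0 hn) 1 (pd d t V) 0 a := by
  have hW := hV.isSym_pd hd t
  set e := pd (i0 hn) 1 (pd d t V) 0 a with he
  have hc := (contDiff_coord (n := n) (i0 hn)).mul (contDiff_const (c := e))
  have := eq_of_forall_der_single_eq_zero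
    ((contDiff_apply_comp hW.contDiff a).sub hc) (x := x) (x' := 0)
    fun b _ z x => by
      rw [der_sub (contDiff_apply_comp hW.contDiff a) hc,
        der_mul_const (contDiff_coord (i0 hn)), der_apply hW.contDiff, pd_coord]
      by_cases hb : b = i0 hn
      · subst hb
        rw [hV.pd_pd_i0 hd ha, Pi.single_eq_same, sub_self]
      · rw [hV.pd_pd_eq_zero hd hb]
        simp [Ne.symm hb]
  rw [← sub_eq_iff_eq_add, this]
  simp

/-- The off-diagonal part of a symmetry. -/
theorem IsSym.exists_pd_of_ne (hV : IsSym hn V) {d : Fin n} (hd : d ≠ i0 hn) {a : Fin n}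
    (ha : a ≠ i0 hn) (had : a ≠ d) : ∃ m, ∀ t x, pd d t V x a = t * m := by
  have h1 : ∀ x, ∃ m, ∀ t, pd d t V x a = 0 + t * m := by
    intro x
    obtain ⟨r, G, -, h⟩ := hV.exists_entries x
    refine ⟨G d a, fun t => ?_⟩
    have := h a d t
    rw [defect_single_of_ne hn V x hd, hV.pd_apply_zero hd, if_neg had] at this
    simpa using this
  have h2 : ∀ t, pd (i0 hn) 1 (pd d t V) 0 a = 0 := by
    intro t
    refine eq_zero_of_mul_left_symm (F := fun t y => pd (i0 hn) y (pd d t V) 0 a)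
      (p := fun y => pd (i0 hn) y (pd d 1 V) 0 a) (q := fun t => pd (i0 hn) 1 (pd d t V) 0 a)
      (fun t y => ?_) (fun t y => hV.pd_pd_i0 hd ha t y 0) t 1
    exact der_pd_eq_mul (k := fun _ => 0) hV.contDiff h1 _ _ t
  obtain ⟨m, hm⟩ := h1 0
  refine ⟨m, fun t x => ?_⟩
  rw [hV.pd_eq hd ha, h2, hm]
  simp

/-- The diagonal part of a symmetry: up to right multiplications it is the left multiplication by
`ρ + q₀ κ`. -/
theorem IsSym.exists_pd_diag (hV : IsSym hn V) {d : Fin n} (hd : d ≠ i0 hn) :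
    ∃ ρ κ m : ℍ[ℝ], ρ.re = 0 ∧ (∀ t x, pd d t V x d = (ρ + x (i0 hn) * κ) * t + t * m) ∧
      ∀ x, ∃ m', ∀ y, pd (i0 hn) y V x (i0 hn) = (ρ + x (i0 hn) * κ) * y + y * m' := by
  have h1 : ∀ x, ∃ r m m' : ℍ[ℝ], r.re = 0 ∧ (∀ t, pd d t V x d = r * t + t * m) ∧
      ∀ y, pd (i0 hn) y V x (i0 hn) = r * y + y * m' := by
    intro x
    obtain ⟨r, G, hr, h⟩ := hV.exists_entries x
    refine ⟨r, G d d, G (i0 hn) (i0 hn), hr, fun t => ?_, fun y => ?_⟩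
    · have := h d d t
      rw [defect_single_of_ne hn V x hd, hV.pd_apply_zero hd] at this
      rw [add_comm (r * t)]
      simpa using this
    · have := h (i0 hn) (i0 hn) y
      rw [defect_single_zero, hV.pd_apply_zero (i0_ne_i1 hn).symm, if_neg (i0_ne_i1 hn)] at this
      rw [add_comm (r * y)]
      simpa using this
  obtain ⟨ρ, m, -, hρ, h0, -⟩ := h1 0
  have hκ : ∀ t, pd (i0 hn) 1 (pd d t V) 0 d = pd (i0 hn) 1 (pd d 1 V) 0 d * t := by
    refine eq_left_mul_of_mul_mem (T := fun t => pd (i0 hn) 1 (pd d t V) 0 d) fun y => ?_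
    obtain ⟨r, m', -, -, h2, -⟩ := h1 (Pi.single (i0 hn) y)
    refine ⟨r - ρ, m' - m, fun t => ?_⟩
    have := hV.pd_eq hd hd t (Pi.single (i0 hn) y)
    rw [h2, h0, Pi.single_eq_same] at this
    rw [sub_mul, mul_sub, ← sub_eq_iff_eq_add'.2 this]
    abel
  set κ := pd (i0 hn) 1 (pd d 1 V) 0 d with hκd
  have h2 : ∀ t x, pd d t V x d = (ρ + x (i0 hn) * κ) * t + t * m := by
    intro t x
    rw [hV.pd_eq hd hd, hκ, h0, add_mul, mul_assoc]
    abel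
  refine ⟨ρ, κ, m, hρ, h2, fun x => ?_⟩
  obtain ⟨r, m1, m2, -, h3, h4⟩ := h1 x
  obtain ⟨h5, -⟩ := eq_coe_of_mul_comm (a := r - (ρ + x (i0 hn) * κ)) (b := m - m1) fun t => by
    have := h3 t
    rw [h2] at this
    rw [sub_mul, mul_sub, sub_eq_sub_iff_add_eq_add, ← this]
    abel
  refine ⟨m2 + (r - (ρ + x (i0 hn) * κ)), fun y => ?_⟩
  have h6 : y * (r - (ρ + x (i0 hn) * κ)) = (r - (ρ + x (i0 hn) * κ)) * y := by
    rw [h5, Quaternion.coe_commutes]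
  rw [h4, mul_add, h6, sub_mul]
  abel

/-- The second derivatives of the component `V₀`. -/
theorem IsSym.pd_pd_i0_i0 (hV : IsSym hn V) {ρ κ : ℍ[ℝ]}
    (h : ∀ x, ∃ m', ∀ y, pd (i0 hn) y V x (i0 hn) = (ρ + x (i0 hn) * κ) * y + y * m')
    (y z : ℍ[ℝ]) (x : Space n) :
    pd (i0 hn) z (pd (i0 hn) y V) x (i0 hn) = z * κ * y + y * κ * z := by
  have hs : ∀ y, ContDiff ℝ ∞ fun x => pd (i0 hn) y V x (i0 hn) := fun y =>
    contDiff_apply_comp (contDiff_der hV.contDiff _) _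
  have hl : ∀ y : ℍ[ℝ], ContDiff ℝ ∞ fun x : Space n => (ρ + x (i0 hn) * κ) * y := fun y =>
    (contDiff_const.add ((contDiff_coord _).mul contDiff_const)).mul contDiff_const
  have hdl : ∀ y z : ℍ[ℝ], pd (i0 hn) z (fun x : Space n => (ρ + x (i0 hn) * κ) * y) x
      = z * κ * y := by
    intro y z
    rw [der_mul_const (contDiff_const.add ((contDiff_coord _).mul contDiff_const)),
      der_add contDiff_const ((contDiff_coord _).mul contDiff_const), der_const,
      der_mul_const (contDiff_coord _), pd_coord, Pi.single_eq_same, zero_add]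
  have h1 : ∀ y z, pd (i0 hn) z (pd (i0 hn) y V) x (i0 hn) - z * κ * y
      = y * (pd (i0 hn) z (pd (i0 hn) 1 V) x (i0 hn) - z * κ) := by
    intro y z
    have e1 : ∀ x, pd (i0 hn) y V x (i0 hn) - (ρ + x (i0 hn) * κ) * y
        = y * (pd (i0 hn) 1 V x (i0 hn) - (ρ + x (i0 hn) * κ) * 1) := by
      intro x
      obtain ⟨m, hm⟩ := h x
      simp [hm]
    have e2 := congrArg (fun f => pd (i0 hn) z f x) (funext e1)
    rw [der_sub (hs y) (hl y), der_const_mul ((hs 1).sub (hl 1)), der_sub (hs 1) (hl 1), hdl, hdl,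
      der_apply (contDiff_der hV.contDiff _), der_apply (contDiff_der hV.contDiff _)] at e2
    simpa using e2
  have h2 : ∀ y z, pd (i0 hn) z (pd (i0 hn) y V) x (i0 hn) - z * κ * y - y * κ * z
      = y * (pd (i0 hn) z (pd (i0 hn) 1 V) x (i0 hn) - z * κ - κ * z) := by
    intro y z
    rw [h1, mul_sub y _ (κ * z), mul_assoc]
  have h3 := eq_zero_of_mul_left_symm
    (F := fun y z => pd (i0 hn) z (pd (i0 hn) y V) x (i0 hn) - z * κ * y - y * κ * z)
    (q := fun y => pd (i0 hn) y (pd (i0 hn) 1 V) x (i0 hn) - y * κ - κ * y) h2 (fun y z => by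
      rw [← h2 z y, der_comm hV.contDiff]
      abel) y z
  rw [sub_sub, sub_eq_zero] at h3
  exact h3

end

/-! ### The symmetries in normal form -/

/-- The field `q_a ↦ ρ q_a + τ_a + ∑ q_b E_{ba}`, corrected by `f_{τ₀}(q₀)` in position `1`. -/
noncomputable def stdField (hn : 2 ≤ n) (ρ : ℍ[ℝ]) (τ : Space n) (E : Fin n → Fin n → ℍ[ℝ]) :
    Space n → Space n := fun x a =>
  ρ * x a + τ a + ∑ b, x b * E b a + if a = i1 hn then quadMap (τ (i0 hn)) (x (i0 hn)) else 0

/-- The coefficient matrices for which `stdField` is a symmetry. -/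
structure IsAdmissible (hn : 2 ≤ n) (E : Fin n → Fin n → ℍ[ℝ]) : Prop where
  col_zero : ∀ b, b ≠ i0 hn → E b (i0 hn) = 0
  row_one : ∀ a, a ≠ i1 hn → E (i1 hn) a = 0
  imJ : (E (i0 hn) (i0 hn)).imJ = 0
  imK : (E (i0 hn) (i0 hn)).imK = 0
  one_one : E (i1 hn) (i1 hn) = E (i0 hn) (i0 hn) + (2 * (E (i0 hn) (i0 hn)).re : ℝ)

theorem contDiff_stdField (hn : 2 ≤ n) (ρ : ℍ[ℝ]) (τ : Space n) (E : Fin n → Fin n → ℍ[ℝ]) :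
    ContDiff ℝ ∞ (stdField hn ρ τ E) := by
  refine contDiff_pi.2 fun a => ?_
  have h1 : ContDiff ℝ ∞ fun x : Space n => ∑ b, x b * E b a :=
    ContDiff.sum fun b _ => (contDiff_coord b).mul contDiff_const
  have h2 : ContDiff ℝ ∞ fun x : Space n =>
      if a = i1 hn then quadMap (τ (i0 hn)) (x (i0 hn)) else 0 := by
    split_ifs
    · exact (contDiff_quadMap _).comp (contDiff_coord _)
    · exact contDiff_const
  exact (((contDiff_const.mul (contDiff_coord a)).add contDiff_const).add h1).add h2

theorem der_comp_coord {f : ℍ[ℝ] → ℍ[ℝ]} (hf : ContDiff ℝ ∞ f) (a : Fin n) (w x : Space n) :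
    der w (fun x => f (x a)) x = der (w a) f (x a) := by
  have h1 : HasFDerivAt (fun x : Space n => x a)
      (ContinuousLinearMap.proj (R := ℝ) (φ := fun _ : Fin n => ℍ[ℝ]) a) x :=
    (ContinuousLinearMap.proj (R := ℝ) (φ := fun _ : Fin n => ℍ[ℝ]) a).hasFDerivAt
  exact congrArg (fun T => T w) ((hasFDerivAt_of_contDiff hf (x a)).comp x h1).fderiv

theorem der_stdField (hn : 2 ≤ n) (ρ : ℍ[ℝ]) (τ : Space n) (E : Fin n → Fin n → ℍ[ℝ])
    (w x : Space n) (a : Fin n) :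
    der w (stdField hn ρ τ E) x a = ρ * w a + ∑ b, w b * E b a
      + if a = i1 hn then w (i0 hn) * quadCoeff (τ (i0 hn)) (x (i0 hn))
          - inner ℝ (τ (i0 hn) * qi) (w (i0 hn)) • (x (i0 hn) * qi)
          - inner ℝ (x (i0 hn) * qi) (w (i0 hn)) • (τ (i0 hn) * qi) else 0 := by
  have h1 : ContDiff ℝ ∞ fun x : Space n => ρ * x a + τ a + ∑ b, x b * E b a :=
    ((contDiff_const.mul (contDiff_coord a)).add contDiff_const).add
      (ContDiff.sum fun b _ => (contDiff_coord b).mul contDiff_const)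
  have h2 : der w (fun x : Space n => ρ * x a + τ a + ∑ b, x b * E b a) x
      = ρ * w a + ∑ b, w b * E b a := by
    refine der_eq_of_expansion (b := 0) (c := 0) h1 fun t => ?_
    simp only [Pi.add_apply, Pi.smul_apply, mul_add, add_mul, Finset.sum_add_distrib,
      smul_mul_assoc, mul_smul_comm, ← Finset.smul_sum]
    module
  rw [← der_apply (contDiff_stdField hn ρ τ E)]
  by_cases ha : a = i1 hn
  · simp only [stdField, if_pos ha]
    rw [der_add (g := fun x : Space n => quadMap (τ (i0 hn)) (x (i0 hn))) h1
      ((contDiff_quadMap _).comp (contDiff_coord _)), h2,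
      der_comp_coord (contDiff_quadMap _), der_quadMap]
  · simp only [stdField, if_neg ha, add_zero]
    exact h2

/-- The converse of `IsSym.exists_entries`. -/
theorem isSym_of_entries (hn : 2 ≤ n) {V : Space n → Space n} (hV : ContDiff ℝ ∞ V)
    (h : ∀ x, ∃ (r : ℍ[ℝ]) (G : Fin n → Fin n → ℍ[ℝ]), ∀ a b y,
      defect hn V x (Pi.single b y) a = y * G b a + if a = b then r * y else 0) : IsSym hn V := by
  refine isSym_of_commutator hn hV fun x => ?_
  obtain ⟨r, G, h⟩ := h x
  refine ⟨r, fun p => ?_⟩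
  have hp : ∀ (p : ℍ[ℝ]) b y, leftMul n p (Pi.single b y) = Pi.single b (p * y) := by
    intro p b y
    funext c
    rw [leftMul_apply]
    by_cases hc : c = b
    · subst hc; simp
    · simp [hc]
  ext1 Y
  rw [← Finset.univ_sum_single Y, map_sum, map_sum]
  refine Finset.sum_congr rfl fun b _ => ?_
  funext a
  change p * defect hn V x (Pi.single b (Y b)) a
    - defect hn V x (leftMul n p (Pi.single b (Y b))) a = _
  rw [hp, hp, h, h]
  by_cases hab : a = b
  · subst hab
    simp [mul_add, sub_mul, mul_assoc]
  · simp [hab, mul_assoc]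

/-- The fields in normal form are symmetries; the conditions on `E` account for the terms of the
symmetry equations which are quadratic in `q₀`. -/
theorem isSym_stdField (hn : 2 ≤ n) {ρ : ℍ[ℝ]} (hρ : ρ.re = 0) (τ : Space n)
    {E : Fin n → Fin n → ℍ[ℝ]} (hE : IsAdmissible hn E) : IsSym hn (stdField hn ρ τ E) := by
  refine isSym_of_entries hn (contDiff_stdField hn ρ τ E) fun x => ⟨ρ, fun b a => E b a
    + if b = i0 hn ∧ a = i1 hn then quadCoeff (τ (i0 hn)) (x (i0 hn)) else 0, fun a b y => ?_⟩
  have h01 := i0_ne_i1 hn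
  have hsum : ∀ (b : Fin n) (y : ℍ[ℝ]) (a : Fin n),
      ∑ c, (Pi.single b y : Space n) c * E c a = y * E b a := by
    intro b y a
    rw [Finset.sum_eq_single b (fun c _ hc => by simp [hc]) (by simp), Pi.single_eq_same]
  have hite : ∀ (a b : Fin n) (y : ℍ[ℝ]), ρ * (Pi.single b y : Space n) a
      = if a = b then ρ * y else 0 := by
    intro a b y
    by_cases hab : a = b
    · subst hab; simp
    · simp [hab]
  by_cases hb : b = i0 hn
  · subst hb
    rw [defect_single_zero]
    simp only [der_stdField, hsum, hite, Pi.single_eq_same]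
    by_cases ha : a = i1 hn
    · subst ha
      have hV0 : stdField hn ρ τ E x (i0 hn)
          = ρ * x (i0 hn) + τ (i0 hn) + x (i0 hn) * E (i0 hn) (i0 hn) := by
        simp only [stdField, if_neg h01, add_zero]
        rw [Finset.sum_eq_single (i0 hn) (fun c _ hc => by rw [hE.col_zero c hc, mul_zero])
          (by simp)]
      rw [hV0, hE.col_zero _ h01.symm, hE.one_one]
      simp only [if_neg h01, if_neg h01.symm, if_true, Pi.single_eq_of_ne h01, zero_mul, mul_zero,
        inner_zero_right, zero_smul, sub_zero, add_zero, zero_add, and_self]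
      have hJ := hE.imJ
      have hK := hE.imK
      generalize E (i0 hn) (i0 hn) = m at *
      generalize E (i0 hn) (i1 hn) = e at *
      generalize x (i0 hn) = q at *
      generalize τ (i0 hn) = t at *
      generalize quadCoeff t q = c
      rw [mul_add y e c]
      have key : inner ℝ ((ρ * q + q * m) * qi) y • (q * qi)
          + inner ℝ (q * qi) y • ((ρ * q + q * m) * qi)
          + inner ℝ (q * qi) (ρ * y + y * m) • (q * qi)
          = inner ℝ (q * qi) y • (ρ * (q * qi) + q * qi * (m + (2 * m.re : ℝ))) := by
        ext <;> simp [Quaternion.inner_def, hJ, hK, hρ] <;> ring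
      have h1 : ρ * q + t + q * m = t + (ρ * q + q * m) := by abel
      rw [h1, add_mul t, inner_add_left (t * qi), ← sub_eq_zero]
      refine Eq.trans ?_ (sub_eq_zero.2 key)
      module
    · rw [hE.row_one a ha]
      simp [ha, add_comm]
  · rw [defect_single_of_ne hn _ x hb]
    simp only [der_stdField, hsum, hite]
    rw [hE.col_zero b hb]
    simp [hb, Ne.symm hb]
    abel

/-! ### The classification of the symmetries -/

section

variable {hn : 2 ≤ n} {V : Space n → Space n}

/-- Integration of the equations for the first two components of a symmetry for which the common
left multiplication `ρ` is constant. -/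
theorem IsSym.first_two_comp (hV : IsSym hn V) {ρ m₁ : ℍ[ℝ]} (hρ : ρ.re = 0)
    (h1 : ∀ t x, pd (i1 hn) t V x (i1 hn) = ρ * t + t * m₁)
    (h0 : ∀ x, ∃ m', ∀ y, pd (i0 hn) y V x (i0 hn) = ρ * y + y * m') :
    ∃ m₀ e₀ : ℍ[ℝ], m₀.imJ = 0 ∧ m₀.imK = 0 ∧ m₁ = m₀ + (2 * m₀.re : ℝ) ∧
      (∀ x, V x (i0 hn) = V 0 (i0 hn) + ρ * x (i0 hn) + x (i0 hn) * m₀) ∧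
      (∀ y x, pd (i0 hn) y V x (i0 hn) = ρ * y + y * m₀) ∧
      ∀ x, V (Pi.single (i0 hn) x) (i1 hn) = V 0 (i1 hn) + x * e₀ + quadMap (V 0 (i0 hn)) x := by
  have h10 := (i0_ne_i1 hn).symm
  have hVs := hV.contDiff
  have hpp := hV.pd_pd_i0_i0 (ρ := ρ) (κ := 0) (by simpa using h0)
  obtain ⟨m₀, hm₀⟩ := h0 0
  have hc1 : ∀ y x, pd (i0 hn) y V x (i0 hn) = ρ * y + y * m₀ := by
    intro y x
    rw [← hm₀]
    refine eq_of_forall_der_single_eq_zero (contDiff_apply_comp (contDiff_der hVs _) _)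
      fun b _ z x => ?_
    rw [der_apply (contDiff_der hVs _)]
    by_cases hb : b = i0 hn
    · subst hb
      simp [hpp]
    · rw [der_comm hVs]
      exact der_apply_eq_zero (contDiff_der hVs _) (hV.pd_apply_zero hb z) _ _
  have hlin : ContDiff ℝ ∞ fun x : Space n => ρ * x (i0 hn) + x (i0 hn) * m₀ :=
    (contDiff_const.mul (contDiff_coord _)).add ((contDiff_coord _).mul contDiff_const)
  have hc0 : ∀ x, V x (i0 hn) = V 0 (i0 hn) + ρ * x (i0 hn) + x (i0 hn) * m₀ := by
    intro x
    have := eq_of_forall_der_single_eq_zero ((contDiff_apply_comp hVs (i0 hn)).sub hlin)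
      (x := x) (x' := 0) fun b _ z x => by
        rw [der_sub (contDiff_apply_comp hVs _) hlin, der_apply hVs,
          der_add (contDiff_const.mul (contDiff_coord _)) ((contDiff_coord _).mul contDiff_const),
          der_const_mul (contDiff_coord _), der_mul_const (contDiff_coord _), pd_coord]
        by_cases hb : b = i0 hn
        · subst hb
          rw [hc1, Pi.single_eq_same, sub_self]
        · rw [hV.pd_apply_zero hb]
          simp [Ne.symm hb]
    simp only [Pi.zero_apply, mul_zero, zero_mul, add_zero, sub_zero] at this
    rw [add_assoc, ← this]
    abel
  have key : ∀ x : ℍ[ℝ], ∃ e, ∀ y, pd (i0 hn) y V (Pi.single (i0 hn) x) (i1 hn)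
      = y * e - inner ℝ (V 0 (i0 hn) * qi) y • (x * qi) - inner ℝ (x * qi) y • (V 0 (i0 hn) * qi)
      - inner ℝ (x * (m₀ * qi + qi * star m₀)) y • (x * qi)
      + inner ℝ (x * qi) y • (x * (qi * m₁ - m₀ * qi)) := by
    intro x
    obtain ⟨r, G, -, h⟩ := hV.exists_entries (Pi.single (i0 hn) x)
    refine ⟨G (i0 hn) (i1 hn), fun y => ?_⟩
    have h2 := h (i1 hn) (i0 hn) y
    rw [defect_single_zero, if_pos rfl, if_neg h10, h1, hc1, hc0 (Pi.single (i0 hn) x),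
      hV.pd_apply_zero h10, inner_zero_right, zero_smul, smul_zero, sub_zero, add_zero,
      Pi.single_eq_same] at h2
    have h3 : inner ℝ (ρ * x * qi) y + inner ℝ (x * qi) (ρ * y) = 0 := by
      simp [Quaternion.inner_def, hρ]
      ring
    have h4 : inner ℝ (x * m₀ * qi) y + inner ℝ (x * qi) (y * m₀)
        = inner ℝ (x * (m₀ * qi + qi * star m₀)) y := by
      simp [Quaternion.inner_def]
      ring
    rw [← h2, ← h4]
    simp only [add_mul, inner_add_left, inner_add_right, ← mul_assoc, mul_sub]
    rw [show inner ℝ (ρ * x * qi) y = - inner ℝ (x * qi) (ρ * y) by linarith]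
    module
  choose e he using key
  -- The integrability conditions put `m₀` into `ℂ` and determine `m₁`.
  obtain ⟨g1, g2, e₀, g3⟩ := quadratic_integrability
    (g := fun x => V (Pi.single (i0 hn) x) (i1 hn)) (e := e) (τ := V 0 (i0 hn))
    (η := m₀ * qi + qi * star m₀) (μ := qi * m₁ - m₀ * qi) (contDiff_comp_single hVs _ _)
    (by simp) (fun x y => by rw [der_comp_single hVs]; exact he x y)
  obtain ⟨a1, a2, a3, a4⟩ := Quaternion.ext_iff.1 g1
  obtain ⟨b1, b2, b3, b4⟩ := Quaternion.ext_iff.1 g2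
  simp at a1 a2 a3 a4 b1 b2 b3 b4
  refine ⟨m₀, e₀, by linarith, by linarith, ?_, hc0, hc1, fun x => ?_⟩
  · ext <;> simp <;> linarith
  · have := g3 x
    simpa using this

/-- The coefficient `κ` of the non-affine left multiplication vanishes: otherwise the brackets with
the corrected translations in the direction of `q₀` would violate `IsSym.first_two_comp`. -/
theorem IsSym.kappa_eq_zero (hV : IsSym hn V) {ρ κ m : ℍ[ℝ]}
    (h1 : ∀ t x, pd (i1 hn) t V x (i1 hn) = (ρ + x (i0 hn) * κ) * t + t * m)
    (h0 : ∀ x, ∃ m', ∀ y, pd (i0 hn) y V x (i0 hn) = (ρ + x (i0 hn) * κ) * y + y * m') :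
    κ = 0 := by
  have h01 := i0_ne_i1 hn
  have hVs := hV.contDiff
  have key : ∀ t : ℍ[ℝ], ∃ a : ℝ, κ * t = a := by
    intro t
    -- `T` is the symmetry extending the translation by `t` in the direction of `q₀`, and
    -- `W = [T, V]` is a symmetry with the constant left multiplication `im (t κ)`.
    have hT : IsSym hn (stdField hn 0 (Pi.single (i0 hn) t) fun _ _ => 0) :=
      isSym_stdField hn (by simp) _ ⟨by simp, by simp, by simp, by simp, by simp⟩
    set T := stdField hn 0 (Pi.single (i0 hn) t) fun _ _ => 0 with hTd
    have hW := hT.lieBracket hV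
    set W := VectorField.lieBracket ℝ T V with hWd
    have hWs := hW.contDiff
    have hTx : ∀ x a, T x a = (if a = i0 hn then t else 0)
        + if a = i1 hn then quadMap t (x (i0 hn)) else 0 := by
      intro x a
      simp [hTd, stdField, Pi.single_apply]
    have hWx : ∀ x a, W x a = ∑ b, pd b (T x b) V x a - der (V x) T x a := by
      intro x a
      rw [hWd, VectorField.lieBracket_eq]
      change der (T x) V x a - der (V x) T x a = _
      rw [der_sum_single, Finset.sum_apply]
    have hsum : ∀ x a, ∑ b, pd b (T x b) V x a
        = pd (i0 hn) t V x a + pd (i1 hn) (quadMap t (x (i0 hn))) V x a := by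
      intro x a
      rw [Finset.sum_eq_add (i0 hn) (i1 hn) h01 (fun b _ hb => by
        simp [hTx, hb.1, hb.2, der]) (by simp) (by simp)]
      simp [hTx, h01, h01.symm]
    have hW0 : ∀ x, W x (i0 hn) = pd (i0 hn) t V x (i0 hn) := by
      intro x
      rw [hWx, hsum, hV.pd_apply_zero h01.symm, hTd, der_stdField]
      simp
    have hWd0 : ∀ y x, pd (i0 hn) y W x (i0 hn) = y * κ * t + t * κ * y := by
      intro y x
      rw [← der_apply hWs, funext hW0, der_apply (contDiff_der hVs _), hV.pd_pd_i0_i0 h0]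
    have hWd1 : ∀ y x, pd (i1 hn) y W x (i1 hn) = t * κ * y := by
      intro y x
      have e1 := contDiff_apply_comp hWs (i1 hn)
      have e2 := contDiff_apply_comp (contDiff_der hVs (Pi.single (i0 hn) t)) (i1 hn)
      have e3 : pd (i1 hn) y (fun x => W x (i1 hn) - pd (i0 hn) t V x (i1 hn)) x = 0 := by
        refine der_eq_of_expansion (b := 0) (c := 0) (e1.sub e2) fun s => ?_
        simp only [smul_zero, add_zero]
        have e4 : V (x + s • (Pi.single (i1 hn) y : Space n)) (i0 hn) = V x (i0 hn) := by
          refine eq_of_forall_der_single_eq_zero (contDiff_apply_comp hVs _) fun b hb z x => ?_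
          have hb' : b ≠ i0 hn := by
            rintro rfl
            simp [h01] at hb
          rw [der_apply hVs, hV.pd_apply_zero hb']
        have e5 : (x + s • (Pi.single (i1 hn) y : Space n)) (i0 hn) = x (i0 hn) := by simp [h01]
        rw [hWx, hWx, hsum, hsum, h1, h1, hTd, der_stdField, der_stdField]
        simp only [e4, e5, Pi.single_eq_same, if_true, mul_zero, zero_mul, Finset.sum_const_zero]
        abel
      rw [der_sub e1 e2, der_apply hWs, der_apply (contDiff_der hVs _), sub_eq_zero] at e3
      rw [e3, der_comm hVs, ← der_apply (contDiff_der hVs _), funext (h1 y)]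
      have c1 := contDiff_coord (n := n) (i0 hn)
      rw [der_add ((contDiff_const.add (c1.mul contDiff_const)).mul contDiff_const) contDiff_const,
        der_const, der_mul_const (contDiff_const.add (c1.mul contDiff_const)),
        der_add contDiff_const (c1.mul contDiff_const), der_const, der_mul_const c1, pd_coord]
      simp
    have hre : t * κ = (t * κ).re + (t * κ).im := (Quaternion.re_add_im _).symm
    obtain ⟨m₀, e₀, -, -, g1, -, g2, -⟩ := hW.first_two_comp (ρ := (t * κ).im)
      (m₁ := ((t * κ).re : ℝ)) (by simp) (fun u x => by
        rw [hWd1, ← Quaternion.coe_commutes, ← add_mul, add_comm, ← hre])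
      (fun x => ⟨κ * t + (t * κ).re, fun y => by
        rw [hWd0, mul_add, ← Quaternion.coe_commutes]
        conv_lhs => rw [hre]
        rw [add_mul, mul_assoc]
        abel⟩)
    have g3 := g2 1 0
    rw [hWd0, one_mul, one_mul, mul_one, mul_one] at g3
    refine ⟨-(2 * m₀.re), ?_⟩
    have g4 : m₀ = κ * t + (t * κ).re := by
      rw [eq_comm, ← add_right_inj (t * κ).im, ← g3]
      conv_rhs => rw [hre]
      abel
    have g5 : κ * t = m₀ - (t * κ).re := by rw [g4]; abel
    rw [g5, g1]
    push_cast
    abel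
  obtain ⟨a, ha⟩ := key 1
  obtain ⟨b, hb⟩ := key qi
  obtain ⟨a1, a2, a3, a4⟩ := Quaternion.ext_iff.1 ha
  obtain ⟨b1, b2, b3, b4⟩ := Quaternion.ext_iff.1 hb
  simp at a1 a2 a3 a4 b1 b2 b3 b4
  ext <;> simp [a2, a3, a4, b2]

/-- Every infinitesimal quaternionic symmetry of the model is one of the fields `stdField`. -/
theorem IsSym.exists_eq_stdField (hV : IsSym hn V) : ∃ (ρ : ℍ[ℝ]) (E : Fin n → Fin n → ℍ[ℝ]),
    ρ.re = 0 ∧ IsAdmissible hn E ∧ V = stdField hn ρ (V 0) E := by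
  have h01 := i0_ne_i1 hn
  have hVs := hV.contDiff
  obtain ⟨ρ, κ, m₁, hρ, h1, h0⟩ := hV.exists_pd_diag h01.symm
  have hκ := hV.kappa_eq_zero h1 h0
  subst hκ
  simp only [mul_zero, add_zero] at h1 h0
  obtain ⟨m₀, e₀, hJ, hK, hm, hc0, hc1, hc2⟩ := hV.first_two_comp hρ h1 h0
  -- The second derivatives of `V₀` show that the left multiplication is the same in all columns.
  have hdiag : ∀ b, b ≠ i0 hn → ∃ m, ∀ t x, pd b t V x b = ρ * t + t * m := by
    intro b hb
    obtain ⟨ρ', κ', m, hρ', g1, g0⟩ := hV.exists_pd_diag hb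
    have k1 := hV.pd_pd_i0_i0 g0 1 1 0
    rw [hV.pd_pd_i0_i0 (ρ := ρ) (κ := 0) (by simpa using h0)] at k1
    have k2 : κ' = 0 := by
      rw [Quaternion.ext_iff] at k1
      obtain ⟨k1, k2, k3, k4⟩ := k1
      simp at k1 k2 k3 k4
      ext <;> simp <;> linarith
    subst k2
    simp only [mul_zero, add_zero] at g0 g1
    obtain ⟨m', hm'⟩ := g0 0
    obtain ⟨k3, -⟩ := eq_coe_of_mul_comm (a := ρ' - ρ) (b := m₀ - m') fun y => by
      have := hm' y
      rw [hc1] at this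
      rw [sub_mul, mul_sub, sub_eq_sub_iff_add_eq_add, ← this]
      abel
    have k4 : ρ' = ρ := by
      rw [Quaternion.re_sub, hρ, hρ', sub_zero, Quaternion.coe_zero] at k3
      exact sub_eq_zero.1 k3
    subst k4
    exact ⟨m, g1⟩
  -- The row `a` of the coefficient matrix, with the expansion of `V_a` along the axis of `q₀`.
  have hrow : ∀ a, ∃ F : Fin n → ℍ[ℝ], a ≠ i0 hn →
      (∀ b, b ≠ i0 hn → ∀ t x, pd b t V x a = (if a = b then ρ * t else 0) + t * F b) ∧
      (∀ x, V (Pi.single (i0 hn) x) a = V 0 a + x * F (i0 hn)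
        + if a = i1 hn then quadMap (V 0 (i0 hn)) x else 0) ∧
      F (i1 hn) = if a = i1 hn then m₁ else 0 := by
    intro a
    by_cases ha : a = i0 hn
    · exact ⟨0, fun h => absurd ha h⟩
    have hF : ∀ b, ∃ m, b ≠ i0 hn → ∀ t x, pd b t V x a
        = (if a = b then ρ * t else 0) + t * m := by
      intro b
      by_cases hb : b = i0 hn
      · exact ⟨0, fun h => absurd hb h⟩
      by_cases hab : a = b
      · subst hab
        obtain ⟨m, hm⟩ := hdiag a ha
        exact ⟨m, fun _ => by simpa using hm⟩
      · obtain ⟨m, hm⟩ := hV.exists_pd_of_ne hb ha hab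
        exact ⟨m, fun _ => by simpa [hab] using hm⟩
    choose F hF using hF
    by_cases ha1 : a = i1 hn
    · subst ha1
      refine ⟨Function.update F (i0 hn) e₀, fun _ => ⟨fun b hb t x => ?_, fun x => ?_, ?_⟩⟩
      · rw [hF b hb, Function.update_of_ne hb]
      · rw [Function.update_self, if_pos rfl, hc2]
      · rw [Function.update_of_ne h01.symm, if_pos rfl]
        have := hF (i1 hn) h01.symm 1 0
        rw [h1] at this
        simpa using this.symm
    · have key : ∀ x : ℍ[ℝ], ∃ e, ∀ y, pd (i0 hn) y V (Pi.single (i0 hn) x) a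
          = y * e - inner ℝ ((0 : ℍ[ℝ]) * qi) y • (x * qi) - inner ℝ (x * qi) y • ((0 : ℍ[ℝ]) * qi)
          - inner ℝ (x * 0) y • (x * qi)
          + inner ℝ (x * qi) y • (x * (qi * F (i1 hn))) := by
        intro x
        obtain ⟨r, G, -, h⟩ := hV.exists_entries (Pi.single (i0 hn) x)
        refine ⟨G (i0 hn) a, fun y => ?_⟩
        have h2 := h a (i0 hn) y
        rw [defect_single_zero, if_neg ha1, if_neg ha, hF _ h01.symm, if_neg ha1, Pi.single_eq_same,
          zero_add, add_zero, add_zero] at h2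
        rw [← h2]
        simp [mul_assoc]
      choose e he using key
      obtain ⟨-, g2, e', g3⟩ := quadratic_integrability
        (g := fun x => V (Pi.single (i0 hn) x) a) (e := e) (τ := 0)
        (η := 0) (μ := qi * F (i1 hn)) (contDiff_comp_single hVs _ _)
        (by simp) (fun x y => by rw [der_comp_single hVs]; exact he x y)
      have hF1 : F (i1 hn) = 0 := by
        rcases mul_eq_zero.1 (g2.trans (by simp)) with h | h
        · exact absurd (congrArg QuaternionAlgebra.imI h) (by simp)
        · exact h
      refine ⟨Function.update F (i0 hn) e', fun _ => ⟨fun b hb t x => ?_, fun x => ?_, ?_⟩⟩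
      · rw [hF b hb, Function.update_of_ne hb]
      · rw [Function.update_self, if_neg ha1]
        have := g3 x
        rw [quadMap_zero_left] at this
        simpa using this
      · rw [Function.update_of_ne h01.symm, if_neg ha1, hF1]
  choose F hF using hrow
  set E : Fin n → Fin n → ℍ[ℝ] := fun b a =>
    if a = i0 hn then if b = i0 hn then m₀ else 0 else F a b with hE
  refine ⟨ρ, E, hρ, ⟨?_, ?_, ?_, ?_, ?_⟩, ?_⟩
  · intro b hb
    simp [hE, hb]
  · intro a ha
    by_cases ha0 : a = i0 hn
    · simp [hE, ha0]
    · simp [hE, ha0, (hF a ha0).2.2, ha]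
  · simpa [hE] using hJ
  · simpa [hE] using hK
  · simp [hE, h01.symm, (hF _ h01.symm).2.2, hm]
  · funext x a
    by_cases ha : a = i0 hn
    · subst ha
      rw [hc0, stdField, if_neg h01, Finset.sum_eq_single (i0 hn) (fun b _ hb => by simp [hE, hb])
        (by simp)]
      simp [hE]
      abel
    · obtain ⟨f1, f2, -⟩ := hF a ha
      have hS := contDiff_stdField hn ρ (V 0) E
      have hd := eq_of_forall_der_single_eq_zero
        ((contDiff_apply_comp hVs a).sub (contDiff_apply_comp hS a)) (x := x)
        (x' := Pi.single (i0 hn) (x (i0 hn))) fun b hb z x => by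
          have hb' : b ≠ i0 hn := by
            rintro rfl
            simp at hb
          rw [der_sub (contDiff_apply_comp hVs a) (contDiff_apply_comp hS a), der_apply hVs,
            der_apply hS, f1 b hb', der_stdField,
            Finset.sum_eq_single b (fun c _ hc => by simp [hc]) (by simp)]
          by_cases hab : a = b
          · subst hab
            simp [hE, ha, Ne.symm ha]
          · simp [hE, ha, hab, Ne.symm hb']
      have hz : V (Pi.single (i0 hn) (x (i0 hn))) a
          - stdField hn ρ (V 0) E (Pi.single (i0 hn) (x (i0 hn))) a = 0 := by
        rw [f2, stdField, Finset.sum_eq_single (i0 hn) (fun c _ hc => by simp [hc]) (by simp)]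
        simp [hE, ha]
      rw [hz] at hd
      exact sub_eq_zero.1 hd

end

/-! ### Commutation with the circle action -/

/-- The derivation `q ↦ (q i - i q) / 2` of the quaternions, with kernel `ℂ = ℝ + ℝ i`. -/
noncomputable def rot (q : ℍ[ℝ]) : ℍ[ℝ] := (2 : ℝ)⁻¹ • (q * qi - qi * q)

theorem rot_eq (q : ℍ[ℝ]) : rot q = ⟨0, 0, q.imK, -q.imJ⟩ := by
  ext <;> simp [rot] <;> ring

theorem rot_re (q : ℍ[ℝ]) : (rot q).re = 0 := by rw [rot_eq]
theorem rot_imI (q : ℍ[ℝ]) : (rot q).imI = 0 := by rw [rot_eq]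
theorem rot_imJ (q : ℍ[ℝ]) : (rot q).imJ = q.imK := by rw [rot_eq]
theorem rot_imK (q : ℍ[ℝ]) : (rot q).imK = -q.imJ := by rw [rot_eq]

theorem rot_eq_zero {q : ℍ[ℝ]} : rot q = 0 ↔ q.imJ = 0 ∧ q.imK = 0 := by
  rw [Quaternion.ext_iff]
  simp [rot_re, rot_imI, rot_imJ, rot_imK, and_comm]

theorem rot_mul (p q : ℍ[ℝ]) : rot (p * q) = rot p * q + p * rot q := by
  simp only [rot, smul_mul_assoc, mul_smul_comm, sub_mul, mul_sub, mul_assoc]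
  module

theorem rot_add (p q : ℍ[ℝ]) : rot (p + q) = rot p + rot q := by
  simp only [rot, add_mul, mul_add]
  module

theorem rot_zero : rot 0 = 0 := by simp [rot]

theorem rot_sum {ι : Type*} (s : Finset ι) (f : ι → ℍ[ℝ]) :
    rot (∑ i ∈ s, f i) = ∑ i ∈ s, rot (f i) :=
  map_sum (⟨⟨rot, rot_zero⟩, rot_add⟩ : ℍ[ℝ] →+ ℍ[ℝ]) f s

theorem rotationL_eq_rot (x : Space n) (a : Fin n) : rotationL n x a = rot (x a) :=
  rotationL_apply' x a

/-- `quadMap` is equivariant under the circle action, infinitesimally. -/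
theorem rot_quadMap (τ x : ℍ[ℝ]) :
    rot (quadMap τ x) = quadMap (rot τ) x + (rot x * quadCoeff τ x
      - inner ℝ (τ * qi) (rot x) • (x * qi) - inner ℝ (x * qi) (rot x) • (τ * qi)) := by
  ext <;> simp [quadMap, quadCoeff, rot_re, rot_imI, rot_imJ, rot_imK, Quaternion.inner_def] <;>
    ring

/-- The bracket of a field in normal form with `v`: the derivation `rot` is applied to the
coefficients. -/
theorem lieBracket_stdField (hn : 2 ≤ n) (ρ : ℍ[ℝ]) (τ : Space n) (E : Fin n → Fin n → ℍ[ℝ])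
    (x : Space n) :
    rotationL n (stdField hn ρ τ E x) - der (rotationL n x) (stdField hn ρ τ E) x
      = stdField hn (rot ρ) (fun a => rot (τ a)) (fun b a => rot (E b a)) x := by
  funext a
  rw [Pi.sub_apply, rotationL_eq_rot, der_stdField]
  simp only [stdField, rotationL_eq_rot, rot_add, rot_mul, rot_sum, Finset.sum_add_distrib]
  split_ifs
  · rw [rot_quadMap]
    abel
  · rw [rot_zero]
    abel

/-- The coefficients of a field in normal form which is a multiple of `v`: they are unique up to
exchanging a real number between `ρ` and the diagonal of `E`. -/
theorem eq_of_stdField_eq_smul (hn : 2 ≤ n) {ρ : ℍ[ℝ]} {τ : Space n} {E : Fin n → Fin n → ℍ[ℝ]}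
    {c : ℝ} (h : ∀ x, stdField hn ρ τ E x = c • rotationL n x) :
    τ = 0 ∧ (∀ a b, a ≠ b → E b a = 0) ∧ ∀ a, ρ + (c / 2) • qi = (ρ.re : ℍ[ℝ]) ∧
      (c / 2) • qi - E a a = ρ + (c / 2) • qi := by
  have hτ : τ = 0 := by
    funext a
    have := congrFun (h 0) a
    simpa [stdField, quadMap_zero] using this
  subst hτ
  have key : ∀ a b y, (if a = b then ρ * y else 0) + y * E b a =
      if a = b then c • rot y else 0 := by
    intro a b y
    have := congrFun (h (Pi.single b y)) a
    rw [Pi.smul_apply, rotationL_eq_rot, stdField,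
      Finset.sum_eq_single b (fun c _ hc => by simp [hc]) (by simp)] at this
    by_cases hab : a = b
    · subst hab
      simpa [quadMap_zero_left] using this
    · simpa [quadMap_zero_left, hab, rot_zero] using this
  refine ⟨rfl, fun a b hab => ?_, fun a => ?_⟩
  · simpa [hab] using key a b 1
  · have := eq_coe_of_mul_comm (a := ρ + (c / 2) • qi) (b := (c / 2) • qi - E a a) fun y => by
      have := key a a y
      rw [if_pos rfl, if_pos rfl, rot] at this
      rw [add_mul, mul_sub, smul_mul_assoc, mul_smul_comm, eq_sub_iff_add_eq, add_right_comm, this]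
      module
    simpa using this

theorem mem_lieSpan_singleton {L : Type*} [LieRing L] [LieAlgebra ℝ L] (v w : L) :
    w ∈ LieSubalgebra.lieSpan ℝ L {v} ↔ ∃ c : ℝ, c • v = w := by
  let K : LieSubalgebra ℝ L :=
    { Submodule.span ℝ {v} with
      lie_mem' := fun {x y} hx hy => by
        obtain ⟨a, rfl⟩ := Submodule.mem_span_singleton.1 hx
        obtain ⟨b, rfl⟩ := Submodule.mem_span_singleton.1 hy
        simp }
  have hK : LieSubalgebra.lieSpan ℝ L {v} ≤ K :=
    LieSubalgebra.lieSpan_le.2 (Set.singleton_subset_iff.2 (Submodule.mem_span_singleton_self v))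
  constructor
  · exact fun h => Submodule.mem_span_singleton.1 (hK h)
  · rintro ⟨c, rfl⟩
    exact (LieSubalgebra.lieSpan ℝ L {v}).smul_mem c (LieSubalgebra.subset_lieSpan rfl)

/-- The condition `[X, v] ∈ ℝ v` in terms of the underlying fields. -/
theorem mem_normalizerAlgebra {hn : 2 ≤ n} (X : modelSymmetries hn) :
    X ∈ normalizerAlgebra hn ↔ ∃ c : ℝ, ∀ x,
      rotationL n (toField X x) - der (rotationL n x) (toField X) x = c • rotationL n x := by
  have hbr : ∀ x, toField ⁅X, circleGen hn⁆ x
      = rotationL n (toField X x) - der (rotationL n x) (toField X) x := by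
    intro x
    change VectorField.lieBracket ℝ (toField X) (rotation n : Space n → Space n) x = _
    rw [coe_rotation, VectorField.lieBracket_eq]
    simp [der]
  have hsm : ∀ (c : ℝ) x, toField (c • circleGen hn) x = c • rotationL n x := by
    intro c x
    change c • (rotation n : Space n → Space n) x = _
    rw [coe_rotation]
  rw [normalizerAlgebra, LieSubalgebra.mem_normalizer_iff]
  constructor
  · intro h
    obtain ⟨c, hc⟩ := (mem_lieSpan_singleton _ _).1 (h _ (LieSubalgebra.subset_lieSpan rfl))
    exact ⟨c, fun x => by rw [← hbr, ← hc, hsm]⟩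
  · rintro ⟨c, hc⟩ Y hY
    obtain ⟨b, rfl⟩ := (mem_lieSpan_singleton _ _).1 hY
    refine (mem_lieSpan_singleton _ _).2 ⟨b * c, ?_⟩
    rw [lie_smul, mul_smul]
    congr 1
    refine Subtype.ext (Subtype.ext (funext fun x => ?_))
    exact (hsm c x).trans ((hc x).symm.trans (hbr x).symm)

theorem isSym_toField {hn : 2 ≤ n} (X : modelSymmetries hn) : IsSym hn (toField X) := isSym_coe X.2

/-- Symmetries with coefficients in `ℂ` commute with `v`. -/
theorem mem_normalizerAlgebra_of_eq {hn : 2 ≤ n} {X : modelSymmetries hn} {ρ : ℍ[ℝ]} {τ : Space n}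
    {E : Fin n → Fin n → ℍ[ℝ]} (h : toField X = stdField hn ρ τ E) (hρ : rot ρ = 0)
    (hτ : ∀ a, rot (τ a) = 0) (hE : ∀ b a, rot (E b a) = 0) : X ∈ normalizerAlgebra hn := by
  refine (mem_normalizerAlgebra X).2 ⟨0, fun x => ?_⟩
  rw [h, lieBracket_stdField]
  funext a
  simp [stdField, hρ, hτ, hE, quadMap_zero_left]

/-- The elements of the normalizer of `v` have coefficients in `ℂ`: as `rot` takes values in the
plane of `j` and `k`, no multiple `c v` with `c ≠ 0` is a bracket with `v`. -/
theorem exists_eq_of_mem_normalizerAlgebra {hn : 2 ≤ n} {X : modelSymmetries hn}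
    (h : X ∈ normalizerAlgebra hn) : ∃ (ρ : ℍ[ℝ]) (τ : Space n) (E : Fin n → Fin n → ℍ[ℝ]),
      ρ.re = 0 ∧ rot ρ = 0 ∧ (∀ a, rot (τ a) = 0) ∧ (∀ b a, rot (E b a) = 0) ∧
      IsAdmissible hn E ∧ toField X = stdField hn ρ τ E := by
  obtain ⟨ρ, E, hρ, hE, hX⟩ := (isSym_toField X).exists_eq_stdField
  obtain ⟨c, hc⟩ := (mem_normalizerAlgebra X).1 h
  rw [hX] at hc
  obtain ⟨h1, h2, h3⟩ := eq_of_stdField_eq_smul hn (c := c) fun x => by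
    rw [← hc x, lieBracket_stdField]
  have h4 : ∀ a, rot ρ = 0 ∧ rot (E a a) = 0 := by
    intro a
    obtain ⟨e1, e2⟩ := h3 a
    rw [rot_re] at e1
    obtain ⟨a1, a2, a3, a4⟩ := Quaternion.ext_iff.1 e1
    simp [rot_re, rot_imI, rot_imJ, rot_imK] at a1 a2 a3 a4
    have hr : rot ρ = 0 := rot_eq_zero.2 ⟨a4, a3⟩
    refine ⟨hr, ?_⟩
    subst a2
    simpa [hr] using e2
  refine ⟨ρ, toField X 0, E, hρ, (h4 (i0 hn)).1, fun a => congrFun h1 a, fun b a => ?_, hE, hX⟩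
  by_cases hab : a = b
  · subst hab
    exact (h4 a).2
  · exact h2 a b hab

/-! ### The dimension -/

/-- The parameters of the normalizer of `v`: the number `ρ / i`, the entry `E₀₀`, the translation
part, and the entries `E_{ba}` with `b ≠ 1`, `a ≠ 0`. -/
abbrev Params (hn : 2 ≤ n) : Type :=
  ((ℝ × ℂ) × (Fin n → ℂ)) × ({b : Fin n // b ≠ i1 hn} × {a : Fin n // a ≠ i0 hn} → ℂ)

/-- The admissible matrix with given parameters. -/
noncomputable def paramMatrix (hn : 2 ≤ n) (p : Params hn) (b a : Fin n) : ℍ[ℝ] :=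
  if h : b ≠ i1 hn ∧ a ≠ i0 hn then Quaternion.ofComplex (p.2 (⟨b, h.1⟩, ⟨a, h.2⟩))
  else if b = i0 hn then Quaternion.ofComplex p.1.1.2
  else if a = i1 hn then Quaternion.ofComplex p.1.1.2 + (2 * p.1.1.2.re : ℝ)
  else 0

theorem quadMap_add (τ τ' x : ℍ[ℝ]) : quadMap (τ + τ') x = quadMap τ x + quadMap τ' x := by
  simp only [quadMap, add_mul, mul_add, inner_add_left]
  module

theorem quadMap_smul (c : ℝ) (τ x : ℍ[ℝ]) : quadMap (c • τ) x = c • quadMap τ x := by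
  simp only [quadMap, smul_mul_assoc, mul_smul_comm, inner_smul_left]
  simp
  module

theorem paramMatrix_add (hn : 2 ≤ n) (p p' : Params hn) (b a : Fin n) :
    paramMatrix hn (p + p') b a = paramMatrix hn p b a + paramMatrix hn p' b a := by
  simp only [paramMatrix]
  split_ifs
  · simp
  · simp
  · simp [mul_add]
    abel
  · simp

theorem paramMatrix_smul (hn : 2 ≤ n) (c : ℝ) (p : Params hn) (b a : Fin n) :
    paramMatrix hn (c • p) b a = c • paramMatrix hn p b a := by
  simp only [paramMatrix]
  split_ifs
  · simp
  · simp
  · rw [show (2 * (c • p).1.1.2.re : ℝ) = c • (2 * p.1.1.2.re) by simp; ring, Quaternion.coe_smul,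
      smul_add]
    simp
  · simp

/-- The elements of the normalizer of `v` in terms of their parameters. -/
noncomputable def paramField (hn : 2 ≤ n) : Params hn →ₗ[ℝ] (Space n → Space n) where
  toFun p := stdField hn (p.1.1.1 • qi) (fun a => Quaternion.ofComplex (p.1.2 a)) (paramMatrix hn p)
  map_add' p p' := by
    funext x a
    simp only [stdField, Pi.add_apply, Prod.fst_add, Prod.snd_add, paramMatrix_add, add_smul,
      add_mul, mul_add, map_add, Finset.sum_add_distrib]
    split_ifs
    · rw [quadMap_add]; abel
    · abel
  map_smul' c p := by
    funext x a
    simp only [stdField, Pi.smul_apply, Prod.smul_fst, Prod.smul_snd, paramMatrix_smul, smul_eq_mul,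
      mul_smul, smul_mul_assoc, mul_smul_comm, map_smul, ← Finset.smul_sum, RingHom.id_apply]
    split_ifs
    · rw [quadMap_smul]; module
    · module

theorem rot_ofComplex (z : ℂ) : rot (Quaternion.ofComplex z) = 0 :=
  rot_eq_zero.2 (by simp)

theorem exists_ofComplex {q : ℍ[ℝ]} (h : rot q = 0) : Quaternion.ofComplex ⟨q.re, q.imI⟩ = q := by
  obtain ⟨h1, h2⟩ := rot_eq_zero.1 h
  ext <;> simp [h1, h2]

theorem rot_smul_qi (r : ℝ) : rot (r • qi) = 0 := rot_eq_zero.2 (by simp)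

theorem rot_coe (r : ℝ) : rot (r : ℍ[ℝ]) = 0 := rot_eq_zero.2 (by simp)

theorem rot_paramMatrix (hn : 2 ≤ n) (p : Params hn) (b a : Fin n) :
    rot (paramMatrix hn p b a) = 0 := by
  unfold paramMatrix
  split_ifs
  · exact rot_ofComplex _
  · exact rot_ofComplex _
  · rw [rot_add, rot_ofComplex, rot_coe, add_zero]
  · exact rot_zero

theorem isAdmissible_paramMatrix (hn : 2 ≤ n) (p : Params hn) :
    IsAdmissible hn (paramMatrix hn p) := by
  have h01 := i0_ne_i1 hn
  refine ⟨fun b hb => ?_, fun a ha => ?_, ?_, ?_, ?_⟩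
  · rw [paramMatrix, dif_neg (by simp), if_neg hb, if_neg h01]
  · rw [paramMatrix, dif_neg (by simp), if_neg h01.symm, if_neg ha]
  · rw [paramMatrix, dif_neg (by simp), if_pos rfl]
    simp
  · rw [paramMatrix, dif_neg (by simp), if_pos rfl]
    simp
  · rw [paramMatrix, dif_neg (by simp), if_neg h01.symm, if_pos rfl, paramMatrix, dif_neg (by simp),
      if_pos rfl]
    simp

theorem isSym_paramField (hn : 2 ≤ n) (p : Params hn) : IsSym hn (paramField hn p) :=
  isSym_stdField hn (by simp) _ (isAdmissible_paramMatrix hn p)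

theorem paramField_injective (hn : 2 ≤ n) : Function.Injective (paramField hn) := by
  rw [← LinearMap.ker_eq_bot, LinearMap.ker_eq_bot']
  rintro ⟨⟨⟨r, z⟩, τ⟩, e⟩ hp
  obtain ⟨h1, h2, h3⟩ := eq_of_stdField_eq_smul hn (c := 0) fun x => by
    rw [zero_smul]
    exact congrFun hp x
  have hinj : ∀ {w : ℂ}, Quaternion.ofComplex w = 0 → w = 0 := fun {w} h => by
    obtain ⟨a1, a2, -⟩ := Quaternion.ext_iff.1 h
    exact Complex.ext (by simpa using a1) (by simpa using a2)
  have hr : r = 0 := by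
    have := congrArg QuaternionAlgebra.imI (h3 (i0 hn)).1
    simpa using this
  subst hr
  have h4 : ∀ b a, paramMatrix hn (((0, z), τ), e) b a = 0 := by
    intro b a
    by_cases hab : a = b
    · subst hab
      simpa using (h3 a).2
    · exact h2 a b hab
  have hz : z = 0 := by
    have := h4 (i0 hn) (i0 hn)
    rw [paramMatrix, dif_neg (by simp), if_pos rfl] at this
    exact hinj this
  have hτ : τ = 0 := funext fun a => hinj (congrFun h1 a)
  have he : e = 0 := by
    funext ⟨⟨b, hb⟩, ⟨a, ha⟩⟩
    have := h4 b a
    rw [paramMatrix, dif_pos ⟨hb, ha⟩] at this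
    exact hinj this
  rw [hz, hτ, he]
  rfl

theorem finrank_params (hn : 2 ≤ n) : Module.finrank ℝ (Params hn) = 2 * n ^ 2 - 2 * n + 5 := by
  have h : Module.finrank ℝ (Params hn) = ((1 + 2) + n * 2) + ((n - 1) * (n - 1)) * 2 := by
    simp [Params, Module.finrank_prod, Module.finrank_pi_fintype, Complex.finrank_real_complex,
      Fintype.card_subtype_compl]
  obtain ⟨k, rfl⟩ : ∃ k, n = k + 1 := ⟨n - 1, by omega⟩
  rw [h, Nat.add_sub_cancel]
  have h2 : 2 * (k + 1) ^ 2 = 2 * (k * k) + 4 * k + 2 := by ring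
  rw [h2]
  omega

/-- The field underlying an element of the normalizer of `v`, as a linear map. -/
noncomputable def normalizerField (hn : 2 ≤ n) :
    normalizerAlgebra hn →ₗ[ℝ] (Space n → Space n) :=
  (smoothFields (Space n)).subtype ∘ₗ (modelSymmetries hn).toSubmodule.subtype ∘ₗ
    (normalizerAlgebra hn).toSubmodule.subtype

theorem normalizerField_injective (hn : 2 ≤ n) : Function.Injective (normalizerField hn) :=
  fun _ _ h => Subtype.ext (Subtype.ext (Subtype.ext h))

theorem range_normalizerField (hn : 2 ≤ n) :
    LinearMap.range (normalizerField hn) = LinearMap.range (paramField hn) := by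
  have h01 := i0_ne_i1 hn
  apply le_antisymm
  · rintro _ ⟨⟨X, hX⟩, rfl⟩
    obtain ⟨ρ, τ, E, hρ, hρ', hτ, hE, hA, h⟩ := exists_eq_of_mem_normalizerAlgebra hX
    refine ⟨(((ρ.imI, ⟨(E (i0 hn) (i0 hn)).re, (E (i0 hn) (i0 hn)).imI⟩),
      fun a => ⟨(τ a).re, (τ a).imI⟩), fun ba => ⟨(E ba.1 ba.2).re, (E ba.1 ba.2).imI⟩), ?_⟩
    refine Eq.trans ?_ h.symm
    change stdField hn _ _ _ = _
    congr 1
    · obtain ⟨h1, h2⟩ := rot_eq_zero.1 hρ'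
      ext <;> simp [hρ, h1, h2]
    · exact funext fun a => exists_ofComplex (hτ a)
    · funext b a
      rw [paramMatrix]
      split_ifs with h1 h2 h3
      · exact exists_ofComplex (hE _ _)
      · subst h2
        have ha : a = i0 hn := by
          by_contra ha
          exact h1 ⟨h01, ha⟩
        rw [ha]
        exact exists_ofComplex (hE _ _)
      · subst h3
        have hb : b = i1 hn := by
          by_contra hb
          exact h1 ⟨hb, h01.symm⟩
        rw [hb, hA.one_one]
        exact congrArg (· + _) (exists_ofComplex (hE _ _))
      · by_cases ha : a = i0 hn
        · rw [ha, hA.col_zero b h2]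
        · have hb : b = i1 hn := by
            by_contra hb
            exact h1 ⟨hb, ha⟩
          rw [hb, hA.row_one a h3]
  · rintro _ ⟨p, rfl⟩
    obtain ⟨hs, hm⟩ := isSym_paramField hn p
    exact ⟨⟨⟨⟨paramField hn p, hs⟩, hm⟩, mem_normalizerAlgebra_of_eq (ρ := p.1.1.1 • qi)
      (τ := fun a => Quaternion.ofComplex (p.1.2 a)) (E := paramMatrix hn p) rfl
      (rot_smul_qi _) (fun a => rot_ofComplex _) (rot_paramMatrix hn p)⟩, rfl⟩

theorem finrank_normalizerAlgebra (hn : 2 ≤ n) :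
    Module.finrank ℝ (normalizerAlgebra hn) = 2 * n ^ 2 - 2 * n + 5 := by
  rw [← finrank_params hn, ← LinearMap.finrank_range_of_inj (normalizerField_injective hn),
    range_normalizerField, LinearMap.finrank_range_of_inj (paramField_injective hn)]

/-! ### The action on the fixed set -/

theorem mem_fixedSet {x : Space n} : x ∈ fixedSet n ↔ rotationL n x = 0 := by
  rw [fixedSet, Set.mem_ofPred_eq, coe_rotation]

theorem mem_tangentConeAt_fixedSet {x w : Space n} (hx : x ∈ fixedSet n) :
    w ∈ tangentConeAt ℝ (fixedSet n) x ↔ rotationL n w = 0 := by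
  rw [mem_fixedSet] at hx
  constructor
  · intro h
    obtain ⟨α, l, hl, c, d, -, hd, hcd⟩ := exists_fun_of_mem_tangentConeAt h
    have h1 : Filter.Tendsto (fun k => rotationL n (c k • d k)) l (nhds (rotationL n w)) :=
      ((rotationL n).continuous.tendsto w).comp hcd
    have h2 : (fun k => rotationL n (c k • d k)) =ᶠ[l] fun _ => 0 := by
      filter_upwards [hd] with k hk
      rw [mem_fixedSet, map_add, hx, zero_add] at hk
      rw [map_smul, hk, smul_zero]
    exact tendsto_nhds_unique h1 (tendsto_const_nhds.congr' h2.symm)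
  · intro h
    have := mem_tangentConeAt_of_segment_subset (s := fixedSet n) (x := x) (y := x + w) (by
      rintro _ ⟨a, b, -, -, -, rfl⟩
      simp [mem_fixedSet, hx, h])
    simpa using this

theorem rotationL_toField {hn : 2 ≤ n} {X : modelSymmetries hn} (hX : X ∈ normalizerAlgebra hn)
    {x : Space n} (hx : x ∈ fixedSet n) : rotationL n (toField X x) = 0 := by
  obtain ⟨c, hc⟩ := (mem_normalizerAlgebra X).1 hX
  have := hc x
  rw [mem_fixedSet.1 hx] at this
  simpa [der] using this

/-- The normalizer of `v` acts transitively on `S`, infinitesimally. -/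
theorem exists_toField_eq (hn : 2 ≤ n) {x w : Space n} (hx : rotationL n x = 0)
    (hw : rotationL n w = 0) : ∃ X ∈ normalizerAlgebra hn, toField X x = w := by
  have h01 := i0_ne_i1 hn
  have hx' : ∀ a, rot (x a) = 0 := fun a => by rw [← rotationL_eq_rot, hx, Pi.zero_apply]
  have hw' : ∀ a, rot (w a) = 0 := fun a => by rw [← rotationL_eq_rot, hw, Pi.zero_apply]
  -- The translation by `w`, with the value of its quadratic correction at `x` subtracted.
  set τ : Space n := w - Pi.single (i1 hn) (quadMap (w (i0 hn)) (x (i0 hn))) with hτ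
  have hτ0 : τ (i0 hn) = w (i0 hn) := by simp [hτ, h01]
  have hq : rot (quadMap (w (i0 hn)) (x (i0 hn))) = 0 := by
    rw [rot_quadMap, hx', hw', quadMap_zero_left]
    simp
  have hrot : ∀ a, rot (τ a) = 0 := by
    intro a
    have : rotationL n τ = 0 := by
      have h1 : rotationL n (Pi.single (i1 hn) (quadMap (w (i0 hn)) (x (i0 hn)))) = 0 := by
        funext b
        rw [rotationL_eq_rot]
        by_cases hb : b = i1 hn
        · subst hb
          rw [Pi.single_eq_same, hq, Pi.zero_apply]
        · rw [Pi.single_eq_of_ne hb, rot_zero, Pi.zero_apply]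
      rw [hτ, map_sub, hw, h1, sub_zero]
    rw [← rotationL_eq_rot, this, Pi.zero_apply]
  obtain ⟨hs, hm⟩ := isSym_stdField hn (ρ := 0) (by simp) τ (E := fun _ _ => 0)
    ⟨by simp, by simp, by simp, by simp, by simp⟩
  refine ⟨⟨⟨_, hs⟩, hm⟩, mem_normalizerAlgebra_of_eq rfl rot_zero hrot fun _ _ => rot_zero, ?_⟩
  change stdField hn 0 τ (fun _ _ => 0) x = w
  funext a
  rw [stdField, hτ0]
  by_cases ha : a = i1 hn
  · subst ha
    simp [hτ]
  · simp [hτ, ha]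

end QuaternionicModel

theorem mainTheorem11 (n : ℕ) (hn : 2 ≤ n) :
    (∀ X ∈ QuaternionicModel.normalizerAlgebra hn, ∀ x ∈ QuaternionicModel.fixedSet n,
      QuaternionicModel.toField X x ∈ tangentConeAt ℝ (QuaternionicModel.fixedSet n) x) ∧
    (∀ x ∈ QuaternionicModel.fixedSet n,
      ∀ w ∈ tangentConeAt ℝ (QuaternionicModel.fixedSet n) x,
        ∃ X ∈ QuaternionicModel.normalizerAlgebra hn, QuaternionicModel.toField X x = w) ∧
    Module.finrank ℝ (QuaternionicModel.normalizerAlgebra hn) = 2 * n ^ 2 - 2 * n + 5 := by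
  refine ⟨fun X hX x hx => ?_, fun x hx w hw => ?_,
    QuaternionicModel.finrank_normalizerAlgebra hn⟩
  · exact (QuaternionicModel.mem_tangentConeAt_fixedSet hx).2
      (QuaternionicModel.rotationL_toField hX hx)
  · exact QuaternionicModel.exists_toField_eq hn (QuaternionicModel.mem_fixedSet.1 hx)
      ((QuaternionicModel.mem_tangentConeAt_fixedSet hx).1 hw)
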